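/- Let $R$ be a principal ideal domain in which $2$ is invertible, with field of fractions $K$, and let $A$ be a commutative Hopf $R$-algebra, finite and flat over $R$, with counit $\varepsilon$. Let $A^D=\mathrm{Hom}_R(A,R)$ be the dual Hopf algebra, with antipode $S^D$. An $A$-comodule $M$ is a left $A^D$-module through $gm=\sum\langle g,m_{(1)}\rangle m_{(0)}$, and $M^A$ denotes its submodule of fixed points (the $m$ with coaction $m\otimes 1$); $A^D$ is the $A$-comodule corresponding to left multiplication. A symmetric bundle over $R$ is a finitely generated projective $R$-module with a symmetric bilinear form whose adjoint map is an isomorphism; it is $A$-equivariant if $M$ is an $A$-comodule and $q(gm,n)=q(m,S^D(g)n)$ for all $g\in A^D$, $m,n\in M$. Let $\theta$ be a generator of the $R$-module of integrals $I(A)=\{x\in A: ax=\varepsilon(a)x\ \ \forall a\in A\}$, and put $\kappa(u,v)=\langle S^D(u)v,\theta\rangle$ for $u,v\in A^D$. (i) $(A^D,\kappa)$ is an $A$-equivariant symmetric bundle. (ii) Suppose that $A$ satisfies $\mathbf H_2$, that is, $A_K=K\otimes_R A$ is a separable $K$-algebra and $\Lambda=\varepsilon(I(A))$ is the square of a principal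 ideal of $R$, and suppose that $\theta$ is chosen such that $\varepsilon(\theta)$ is a square in $R$. Let $s$ be a generator of the ideal $\Lambda^{1/2}$. Let $B$ be a principal homogeneous space for $A$, i.e. a commutative finite flat $R$-algebra with an $A$-comodule algebra structure $\alpha$ such that $B^A=R$ and $B\otimes_R B\to B\otimes_R A$, $b\otimes b'\mapsto(b\otimes1)\alpha(b')$, is an isomorphism. Put $\mathcal D^{-1/2}(B)=\Lambda^{-1/2}B=s^{-1}B\subset B_K=K\otimes_R B$, with the coaction induced by $\alpha$, and let $Tr$ be the form $(x,y)\mapsto Tr_{B_K/K}(xy)$ on it. Then $Tr$ takes values in $R$, $(\mathcal D^{-1/2}(B),Tr)$ is a symmetric bundle, and the twist of $(A^D,\kappa)$ by $B$ is a well defined symmetric bundle isometric to $(\mathcal D^{-1/2}(B),Tr)$. Here the twist of $(M,q)$ by $B$ is $(\mathcal D^{-1/2}(B)\otimes_R M,\,Tr\otimes q)^A$, with the diagonal comodule structure on the tensor product, where for a comodule $N$ with form $h$ the form $h^A$ on $N^A=\theta^DN$ is given by $h^A(x,y)=h(m,y)=h(x,n)$ whenever $x=\theta^Dm$, $y=\theta^Dn$;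 here $\theta^D$ is the element of $A^D$ with $\theta^D\theta_s=1_A$, where $\theta_s$ is the generator of $I(A)$ with $\varepsilon(\theta_s)=s^2$. -/

import Mathlib

open scoped TensorProduct nonZeroDivisors

namespace HopfTwist

universe u v w x y

section Comodules

variable {R : Type u} [CommRing R] {A : Type v} [CommRing A]

/-- The dual algebra `A^D = Hom_R(A, R)`, with the convolution product
`⟨f * g, a⟩ = ∑ ⟨f, a₍₁₎⟩ ⟨g, a₍₂₎⟩`. -/
abbrev DualAlg (R : Type u) [CommRing R] (A : Type v) [CommRing A] [HopfAlgebra R A] : Type _ :=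
  WithConv (A →ₗ[R] R)

/-- The antipode `S^D` of `A^D`: `⟨S^D u, a⟩ = ⟨u, S a⟩`. -/
noncomputable def dualAntipode [HopfAlgebra R A] : DualAlg R A →ₗ[R] DualAlg R A where
  toFun u := WithConv.toConv (u.ofConv ∘ₗ HopfAlgebra.antipode R)
  map_add' _ _ := rfl
  map_smul' _ _ := rfl

/-- `α : M → M ⊗ A` is a (coassociative and counital) right `A`-comodule structure. -/
structure IsComodule [HopfAlgebra R A] {M : Type w} [AddCommMonoid M] [Module R M]
    (α : M →ₗ[R] M ⊗[R] A) : Prop where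
  coassoc : (TensorProduct.assoc R M A A).toLinearMap ∘ₗ α.rTensor A ∘ₗ α =
    (Coalgebra.comul (R := R) (A := A)).lTensor M ∘ₗ α
  counit_id : ∀ m : M,
    TensorProduct.rid R M ((Coalgebra.counit (R := R) (A := A)).lTensor M (α m)) = m

/-- The action of `g ∈ A^D` on an `A`-comodule: `g m = ∑ ⟨g, m₍₁₎⟩ m₍₀₎`. -/
noncomputable def dualAct [HopfAlgebra R A] {M : Type w} [AddCommMonoid M] [Module R M]
    (α : M →ₗ[R] M ⊗[R] A) (g : DualAlg R A) : M →ₗ[R] M :=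
  (TensorProduct.rid R M).toLinearMap ∘ₗ g.ofConv.lTensor M ∘ₗ α

/-- The fixed points `M^A = {m | α m = m ⊗ 1}`. -/
def fixedPoints [HopfAlgebra R A] {M : Type w} [AddCommMonoid M] [Module R M]
    (α : M →ₗ[R] M ⊗[R] A) : Submodule R M :=
  LinearMap.eqLocus α ((TensorProduct.mk R M A).flip 1)

/-- The tensor product of two comodules: `m ⊗ n ↦ ∑ m₍₀₎ ⊗ n₍₀₎ ⊗ m₍₁₎ n₍₁₎`. -/
noncomputable def tensorCoaction [HopfAlgebra R A]
    {M : Type w} [AddCommMonoid M] [Module R M] {N : Type x} [AddCommMonoid N] [Module R N]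
    (α : M →ₗ[R] M ⊗[R] A) (β : N →ₗ[R] N ⊗[R] A) :
    M ⊗[R] N →ₗ[R] (M ⊗[R] N) ⊗[R] A :=
  (LinearMap.mul' R A).lTensor (M ⊗[R] N) ∘ₗ
    (TensorProduct.tensorTensorTensorComm R M A N A).toLinearMap ∘ₗ TensorProduct.map α β

/-- The module `I(A)` of (left) integrals of `A`. -/
def integrals (R : Type u) [CommRing R] (A : Type v) [CommRing A] [HopfAlgebra R A] :
    Submodule R A where
  carrier := {z | ∀ a : A, a * z = Coalgebra.counit (R := R) a • z}
  add_mem' := by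
    intro y z hy hz a
    simp only [Set.mem_ofPred_eq] at hy hz
    rw [mul_add, smul_add, hy, hz]
  zero_mem' := by intro a; simp
  smul_mem' := by
    intro c z hz a
    simp only [Set.mem_ofPred_eq] at hz
    rw [mul_smul_comm, hz, smul_comm]

/-- `θ` generates the module of integrals of `A`. -/
def IsIntegralGenerator (R : Type u) [CommRing R] {A : Type v} [CommRing A] [HopfAlgebra R A]
    (θ : A) : Prop :=
  Submodule.span R {θ} = integrals R A

/-- The `A`-comodule structure on `A^D` that corresponds to left multiplication of `A^D` on
itself (`dualAct_regularCoaction` below). Under the isomorphism `A^D ⊗ A ≃ Hom_R(A, A)` sending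
`f ⊗ a` to `x ↦ ⟨f, x⟩ a`, the image of `f` is `x ↦ f x = ∑ ⟨f, x₍₂₎⟩ x₍₁₎`. -/
noncomputable def regularCoaction [HopfAlgebra R A] [Module.Finite R A] [Module.Projective R A] :
    DualAlg R A →ₗ[R] DualAlg R A ⊗[R] A :=
  ((WithConv.linearEquiv R (A →ₗ[R] R)).symm.toLinearMap).rTensor A ∘ₗ
    (dualTensorHomEquiv R A A).symm.toLinearMap ∘ₗ
    { toFun := fun f => dualAct (Coalgebra.comul (R := R) (A := A)) f
      map_add' := by
        intro f g
        simp [dualAct, LinearMap.lTensor_add, LinearMap.add_comp, LinearMap.comp_add]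
      map_smul' := by
        intro c f
        simp [dualAct, LinearMap.lTensor_smul, LinearMap.smul_comp, LinearMap.comp_smul] }

theorem dualAct_regularCoaction [HopfAlgebra R A] [Module.Finite R A] [Module.Projective R A]
    (g f : DualAlg R A) : dualAct (regularCoaction (R := R) (A := A)) g f = g * f := by
  have key : ∀ z : Module.Dual R A ⊗[R] A, ∀ x : A,
      (TensorProduct.rid R (DualAlg R A) (g.ofConv.lTensor (DualAlg R A)
        (((WithConv.linearEquiv R (A →ₗ[R] R)).symm.toLinearMap).rTensor A z))).ofConv x =
      g.ofConv (dualTensorHom R A A z x) := by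
    intro z x
    induction z with
    | zero => simp
    | tmul h a => simp [mul_comm]
    | add z w hz hw =>
      simp only [map_add, LinearMap.add_apply, WithConv.ofConv_add, hz, hw]
  have h2 : ∀ t : A ⊗[R] A,
      g.ofConv (TensorProduct.rid R A (f.ofConv.lTensor A t)) =
        LinearMap.mul' R R (TensorProduct.map g.ofConv f.ofConv t) := by
    intro t
    induction t with
    | zero => simp
    | tmul a b => simp [mul_comm]
    | add z w hz hw => simp only [map_add, hz, hw]
  apply WithConv.ofConv_injective
  ext x
  have h1 := key ((dualTensorHomEquiv R A A).symm
    (dualAct (Coalgebra.comul (R := R) (A := A)) f)) x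
  have h3 : dualTensorHom R A A ((dualTensorHomEquiv R A A).symm
      (dualAct (Coalgebra.comul (R := R) (A := A)) f)) =
      dualAct (Coalgebra.comul (R := R) (A := A)) f :=
    (dualTensorHomEquiv R A A).apply_symm_apply _
  rw [h3] at h1
  refine h1.trans ?_
  exact h2 _

end Comodules

section Bundles

variable {R : Type u} [CommRing R]

/-- A symmetric bundle over `R`: a finitely generated, locally free (that is, projective)
`R`-module with a symmetric bilinear form whose adjoint `M → Hom_R(M, R)` is an isomorphism. -/
structure IsSymmetricBundle {M : Type w} [AddCommMonoid M] [Module R M]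
    (q : LinearMap.BilinForm R M) : Prop where
  finite : Module.Finite R M
  projective : Module.Projective R M
  symm : ∀ m n : M, q m n = q n m
  nondegenerate : Function.Bijective (q : M → M →ₗ[R] R)

/-- Isometry of symmetric bundles. -/
def Isometric {M : Type w} [AddCommMonoid M] [Module R M] {N : Type x} [AddCommMonoid N] [Module R N]
    (q : LinearMap.BilinForm R M) (q' : LinearMap.BilinForm R N) : Prop :=
  ∃ e : M ≃ₗ[R] N, ∀ m n : M, q' (e m) (e n) = q m n

/-- `(M, q)`, with the coaction `α`, is an `A`-equivariant symmetric bundle. -/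
structure IsEquivariantSymmetricBundle {A : Type v} [CommRing A] [HopfAlgebra R A]
    {M : Type w} [AddCommMonoid M] [Module R M]
    (α : M →ₗ[R] M ⊗[R] A) (q : LinearMap.BilinForm R M) : Prop where
  isSymmetricBundle : IsSymmetricBundle q
  isComodule : IsComodule α
  equivariant : ∀ (g : DualAlg R A) (m n : M),
    q (dualAct α g m) n = q m (dualAct α (dualAntipode g) n)

/-- The form `κ(u, v) = ⟨S^D(u) v, θ⟩` on `A^D`. -/
noncomputable def unitForm {A : Type v} [CommRing A] [HopfAlgebra R A] (θ : A) :
    LinearMap.BilinForm R (DualAlg R A) :=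
  LinearMap.mk₂ R (fun u v => (dualAntipode u * v).ofConv θ)
    (by intro u u' v; simp [add_mul])
    (by intro c u v; simp)
    (by intro u v v'; simp [mul_add])
    (by intro c u v; rw [mul_smul_comm]; rfl)

/-- `qA` is the form `q^A` on `M^A` attached to the integral `θD` of `A^D`: one has
`M^A = θD M`, and `q^A(x, y) = q(m, y) = q(x, n)` whenever `x = θD m` and `y = θD n`.
These requirements determine `qA`. -/
structure IsFixedPointForm {A : Type v} [CommRing A] [HopfAlgebra R A]
    {M : Type w} [AddCommMonoid M] [Module R M]
    (α : M →ₗ[R] M ⊗[R] A) (q : LinearMap.BilinForm R M) (θD : DualAlg R A)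
    (qA : LinearMap.BilinForm R (fixedPoints α)) : Prop where
  range_eq : LinearMap.range (dualAct α θD) = fixedPoints α
  left : ∀ (m : M) (x y : fixedPoints α), dualAct α θD m = x → qA x y = q m y
  right : ∀ (n : M) (x y : fixedPoints α), dualAct α θD n = y → qA x y = q x n

end Bundles

section Twists

variable {R : Type u} [CommRing R] {A : Type v} [CommRing A] [HopfAlgebra R A]

/-- The commutative finite flat `R`-algebra `B`, with the comodule algebra structure `α`, is a
principal homogeneous space for `A`: `B^A = R`, and `B ⊗ B → B ⊗ A`, `b ⊗ b' ↦ (b ⊗ 1) α(b')`,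
is bijective. (This map is always a homomorphism of `B`-algebras and of left `A^D`-modules.) -/
structure IsPHS {B : Type w} [CommRing B] [Algebra R B] [Module.Finite R B] [Module.Flat R B]
    (α : B →ₐ[R] B ⊗[R] A) : Prop where
  isComodule : IsComodule α.toLinearMap
  algebraMap_injective : Function.Injective (algebraMap R B)
  fixed : ∀ b : B, b ∈ fixedPoints α.toLinearMap ↔ b ∈ Set.range (algebraMap R B)
  bijective : Function.Bijective
    (Algebra.TensorProduct.lift (Algebra.TensorProduct.includeLeft : B →ₐ[B] B ⊗[R] A) α
      (fun _ _ => Commute.all _ _) : B ⊗[R] B →ₐ[B] B ⊗[R] A)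

/-- The hypothesis `H₂`: `A_K` is a separable (equivalently étale, as it is commutative and
finite) `K`-algebra and `ε(I(A))` is the square of a principal ideal of `R`. -/
structure HypothesisH2 (R : Type u) [CommRing R] (A : Type v) [CommRing A] [HopfAlgebra R A]
    (K : Type x) [Field K] [Algebra R K] : Prop where
  separable : Algebra.Etale K (K ⊗[R] A)
  square : ∃ s : R, (integrals R A).map (Coalgebra.counit (R := R) (A := A)) =
    (Ideal.span {s} ^ 2 : Ideal R)

/-- The map `b ↦ s⁻¹ b` from `B` to `B_K = K ⊗ B`. -/
noncomputable def invSMul (K : Type x) [Field K] [Algebra R K] (B : Type w) [CommRing B]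
    [Algebra R B] (s : R) : B →ₗ[R] K ⊗[R] B :=
  TensorProduct.mk R K B (algebraMap R K s)⁻¹

theorem invSMul_injective [IsDomain R] (K : Type x) [Field K] [Algebra R K] [IsFractionRing R K]
    (B : Type w) [CommRing B] [Algebra R B] [Module.Flat R B] (s : R⁰) :
    Function.Injective (invSMul K B (s : R)) := by
  have hs : algebraMap R K (s : R) ≠ 0 := by
    simp
  have h1 : Function.Injective ((Algebra.linearMap R K).rTensor B) :=
    Module.Flat.rTensor_preserves_injective_linearMap _ (IsFractionRing.injective R K)
  intro b c h
  apply (TensorProduct.lid R B).symm.injective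
  apply h1
  have h2 := congrArg (fun z => (algebraMap R K (s : R)) • z) h
  simpa [invSMul, TensorProduct.smul_tmul', Algebra.smul_def, hs] using h2

/-- `𝒟^{-1/2}(B) = Λ^{-1/2} B = s⁻¹ B ⊆ B_K`, where `s` generates `Λ^{1/2}`. -/
noncomputable def sqrtCodiff (K : Type x) [Field K] [Algebra R K] (B : Type w) [CommRing B]
    [Algebra R B] (s : R) : Submodule R (K ⊗[R] B) :=
  LinearMap.range (invSMul K B s)

/-- Multiplication by `s⁻¹` as an isomorphism from `B` onto `s⁻¹ B`. -/
noncomputable def sqrtCodiffEquiv [IsDomain R] (K : Type x) [Field K] [Algebra R K]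
    [IsFractionRing R K] (B : Type w) [CommRing B] [Algebra R B] [Module.Flat R B] (s : R⁰) :
    B ≃ₗ[R] sqrtCodiff K B (s : R) :=
  LinearEquiv.ofInjective (invSMul K B (s : R)) (invSMul_injective K B s)

/-- The coaction on `𝒟^{-1/2}(B) = s⁻¹ B`, the restriction of the `K`-linear extension of the
coaction `α` of `B`: `s⁻¹ b ↦ ∑ s⁻¹ b₍₀₎ ⊗ b₍₁₎`. -/
noncomputable def sqrtCodiffCoaction [IsDomain R] (K : Type x) [Field K] [Algebra R K]
    [IsFractionRing R K] {B : Type w} [CommRing B] [Algebra R B] [Module.Flat R B]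
    (α : B →ₐ[R] B ⊗[R] A) (s : R⁰) :
    sqrtCodiff K B (s : R) →ₗ[R] sqrtCodiff K B (s : R) ⊗[R] A :=
  (sqrtCodiffEquiv K B s).toLinearMap.rTensor A ∘ₗ α.toLinearMap ∘ₗ
    (sqrtCodiffEquiv K B s).symm.toLinearMap

/-- `T` is the (`R`-valued) trace form `(x, y) ↦ Tr_{B_K/K}(xy)` on `𝒟^{-1/2}(B)`. -/
def IsTraceForm {K : Type x} [Field K] [Algebra R K] {B : Type w} [CommRing B]
    [Algebra R B] {s : R} (T : LinearMap.BilinForm R (sqrtCodiff K B s)) : Prop :=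
  ∀ x y : sqrtCodiff K B s,
    algebraMap R K (T x y) = Algebra.trace K (K ⊗[R] B) ((x : K ⊗[R] B) * (y : K ⊗[R] B))

/-- `qt` is the form of the twist `(𝒟^{-1/2}(B) ⊗ M, Tr ⊗ q)^A` of `(M, q)` by `B`, where the
fixed-point form is the one attached to the element `θD` of `A^D` with `θD θ = 1`, for the generator
`θ = λ e` of `I(A)`. Here `s = λ^{1/2}`, and `θ = λ e` is the integral with `ε(θ) = λ = s²`, since
`e` is the integral of `A_K` with `ε(e) = 1`. -/
def IsTwist [IsDomain R] {K : Type x} [Field K] [Algebra R K] [IsFractionRing R K]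
    {B : Type w} [CommRing B] [Algebra R B] [Module.Flat R B] (α : B →ₐ[R] B ⊗[R] A) (s : R⁰)
    {M : Type y} [AddCommMonoid M] [Module R M]
    (β : M →ₗ[R] M ⊗[R] A) (q : LinearMap.BilinForm R M)
    (qt : LinearMap.BilinForm R (fixedPoints (tensorCoaction (sqrtCodiffCoaction K α s) β))) :
    Prop :=
  ∃ (T : LinearMap.BilinForm R (sqrtCodiff K B (s : R))) (θ : A) (θD : DualAlg R A),
    IsTraceForm T ∧ IsIntegralGenerator R θ ∧ Coalgebra.counit (R := R) θ = (s : R) ^ 2 ∧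
    dualAct (Coalgebra.comul (R := R) (A := A)) θD θ = 1 ∧
    IsFixedPointForm (tensorCoaction (sqrtCodiffCoaction K α s) β)
      (LinearMap.BilinForm.tmul T q) θD qt

end Twists

end HopfTwist

namespace HopfTwist

/-! ### Antipode identities for `A` and its dual -/

section HopfIdentities

open Coalgebra Bialgebra HopfAlgebra WithConv

variable {R : Type*} [CommRing R] {A : Type*} [CommRing A] [HopfAlgebra R A]

/-! The key is Frobenius duality. A Hopf-module projection of `A` onto its integrals shows that `v ↦
vθ` is a bijection from `A^D` to `A` (`IsIntegralGenerator.bijective`) and that `S θ = θ`. Since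
`κ(u, v) = ⟨S^D u, vθ⟩`, the first fact makes `κ` nondegenerate and the second makes it symmetric.

For the twist, rescale `θ` by a unit square to `θs` with `ε(θs) = s²`, and let `ψ` satisfy `ψ θs =
1`. Then `ψ` is an integral of `A^D`, so it maps `B` into `B^A = R` and defines a functional `τ`.
The preimage of `1 ⊗ θs` in `B ⊗ B` is a Casimir element for `τ` (`IsComodule.casimir`). Hence `(b,
c) ↦ τ(bc)` is unimodular, `τ` is surjective, and `Tr = s² τ`. Dividing `B` by `s` cancels `s²`, so
the trace form on `s⁻¹B` is the form of `τ`. The case `B = A` shows that `ψ` is a multiple of a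
trace, hence fixed by `S^D` and two-sided.

With `ε(θ) = (s v)²`, the isometry sends `x` to `v⁻¹ ψ(x ⊗ 1)`. It is onto because `ψ(d ⊗ f) =
ψ(S^D(f) d ⊗ 1)`, and it preserves forms because `(Tr ⊗ κ)(x ⊗ 1, ψ(y ⊗ 1)) = Tr(x, y) ψ(θ)` with
`ψ(θ) = v²`. -/

theorem antipode_antipode (a : A) : antipode R (antipode R a) = a := by
  have h := inv_inv (toConv (AlgHom.id R A))
  exact DFunLike.congr_fun (congrArg ofConv h) a

/-- Algebra maps from `A` to a commutative algebra form a group under convolution, with inverse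
given by composing with the antipode. Factoring `Δ` in this group turns the antipode identities
below into cancellation laws and the rule for inverting a product. -/
theorem comul_eq_convMul : toConv (comulAlgHom R A) =
    toConv (Algebra.TensorProduct.includeLeft : A →ₐ[R] A ⊗[R] A) *
      toConv (Algebra.TensorProduct.includeRight : A →ₐ[R] A ⊗[R] A) := by
  rw [AlgHom.convMul_def]
  apply WithConv.ofConv_injective
  apply AlgHom.ext
  intro a
  simp only [AlgHom.comp_apply]
  generalize (comulAlgHom R A) a = t
  induction t with
  | zero => simp
  | tmul x y => simp
  | add x y hx hy => simp only [map_add]; rw [← hx, ← hy]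

/-- `∑ Δ(a₍₁₎) (1 ⊗ S(a₍₂₎)) = a ⊗ 1`. -/
theorem sum_comul_mul_antipode {a : A} {ι : Type*} (𝓡 : Coalgebra.Repr R a ι) :
    ∑ i ∈ 𝓡.index, comul (R := R) (𝓡.left i) * ((1 : A) ⊗ₜ[R] antipode R (𝓡.right i)) =
      a ⊗ₜ[R] 1 := by
  have h : toConv (comulAlgHom R A) *
      (toConv (Algebra.TensorProduct.includeRight : A →ₐ[R] A ⊗[R] A))⁻¹ =
      toConv (Algebra.TensorProduct.includeLeft : A →ₐ[R] A ⊗[R] A) := by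
    rw [comul_eq_convMul]
    exact mul_inv_cancel_right (G := WithConv (A →ₐ[R] A ⊗[R] A)) _ _
  have h' := DFunLike.congr_fun (congrArg ofConv h) a
  rw [AlgHom.convMul_def] at h'
  simp only [AlgHom.comp_apply, comulAlgHom_apply, ← 𝓡.eq, map_sum,
    Algebra.TensorProduct.map_tmul, Algebra.TensorProduct.lmul'_apply_tmul] at h'
  exact h'

/-- `∑ (S(a₍₁₎) ⊗ 1) Δ(a₍₂₎) = 1 ⊗ a`. -/
theorem sum_antipode_mul_comul {a : A} {ι : Type*} (𝓡 : Coalgebra.Repr R a ι) :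
    ∑ i ∈ 𝓡.index, (antipode R (𝓡.left i) ⊗ₜ[R] (1 : A)) * comul (R := R) (𝓡.right i) =
      (1 : A) ⊗ₜ[R] a := by
  have h : (toConv (Algebra.TensorProduct.includeLeft : A →ₐ[R] A ⊗[R] A))⁻¹ *
      toConv (comulAlgHom R A) =
      toConv (Algebra.TensorProduct.includeRight : A →ₐ[R] A ⊗[R] A) := by
    rw [comul_eq_convMul]
    exact inv_mul_cancel_left (G := WithConv (A →ₐ[R] A ⊗[R] A)) _ _
  have h' := DFunLike.congr_fun (congrArg ofConv h) a
  rw [AlgHom.convMul_def] at h'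
  simp only [AlgHom.comp_apply, comulAlgHom_apply, ← 𝓡.eq, map_sum,
    Algebra.TensorProduct.map_tmul, Algebra.TensorProduct.lmul'_apply_tmul] at h'
  exact h'

theorem comul_antipode (a : A) : comul (R := R) (antipode R a) =
    TensorProduct.comm R A A (TensorProduct.map (antipode R) (antipode R) (comul a)) := by
  have h := (congrArg (·⁻¹) (comul_eq_convMul (R := R) (A := A))).trans (mul_inv_rev (G := WithConv (A →ₐ[R] A ⊗[R] A)) _ _)
  have h' := DFunLike.congr_fun (congrArg ofConv h) a
  refine (show _ = _ from h').trans ?_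
  rw [AlgHom.convMul_def]
  simp only [AlgHom.comp_apply, comulAlgHom_apply]
  generalize comul (R := R) a = t
  induction t with
  | zero => simp
  | tmul x y =>
    change ((1 : A) ⊗ₜ[R] antipode R x) * (antipode R y ⊗ₜ[R] (1 : A)) = _
    simp
  | add x y hx hy => simp only [map_add, hx, hy]

@[simp] theorem dualAntipode_apply (u : DualAlg R A) (a : A) :
    (dualAntipode u).ofConv a = u.ofConv (antipode R a) := rfl

theorem dualAntipode_dualAntipode (u : DualAlg R A) : dualAntipode (dualAntipode u) = u := by
  apply WithConv.ofConv_injective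
  ext a
  simp [antipode_antipode]

theorem dualAntipode_one : dualAntipode (1 : DualAlg R A) = 1 := by
  apply WithConv.ofConv_injective
  ext a
  change counit (R := R) (antipode R a) = counit a
  simp

theorem dual_one_apply (a : A) : (1 : DualAlg R A).ofConv a = counit (R := R) a := rfl

theorem dualAntipode_mul (u v : DualAlg R A) :
    dualAntipode (u * v) = dualAntipode v * dualAntipode u := by
  apply WithConv.ofConv_injective
  ext a
  change LinearMap.mul' R R (TensorProduct.map u.ofConv v.ofConv (comul (R := R) (antipode R a))) =
    LinearMap.mul' R R (TensorProduct.map (dualAntipode v).ofConv (dualAntipode u).ofConv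
      (comul (R := R) a))
  rw [comul_antipode]
  generalize comul (R := R) a = t
  induction t with
  | zero => simp
  | tmul x y => simp [mul_comm]
  | add x y hx hy => simp only [map_add, hx, hy]

end HopfIdentities

/-! ### The action of the dual algebra on comodules -/

section DualAction

open Coalgebra Bialgebra HopfAlgebra WithConv

variable {R : Type*} [CommRing R] {A : Type*} [CommRing A] [HopfAlgebra R A]
  {M : Type*} [AddCommMonoid M] [Module R M] {N : Type*} [AddCommMonoid N] [Module R N]

/-- The contraction `m ⊗ a ↦ ⟨g, a⟩ m`. -/
noncomputable def contr (M : Type*) [AddCommMonoid M] [Module R M] (g : DualAlg R A) :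
    M ⊗[R] A →ₗ[R] M :=
  (TensorProduct.rid R M).toLinearMap ∘ₗ g.ofConv.lTensor M

@[simp] theorem contr_tmul (g : DualAlg R A) (m : M) (a : A) :
    contr M g (m ⊗ₜ[R] a) = g.ofConv a • m := by
  simp [contr]

theorem dualAct_apply (α : M →ₗ[R] M ⊗[R] A) (g : DualAlg R A) (m : M) :
    dualAct α g m = contr M g (α m) := rfl

theorem contr_add (g h : DualAlg R A) (t : M ⊗[R] A) :
    contr M (g + h) t = contr M g t + contr M h t := by
  simp [contr, LinearMap.lTensor_add]

theorem contr_smul (c : R) (h : DualAlg R A) (t : M ⊗[R] A) :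
    contr M (c • h) t = c • contr M h t := by
  simp [contr, LinearMap.lTensor_smul]

/-- The action of `A^D` on a comodule as a bilinear map. -/
noncomputable def dualActₗ (α : M →ₗ[R] M ⊗[R] A) : DualAlg R A →ₗ[R] M →ₗ[R] M :=
  LinearMap.mk₂ R (fun g m => dualAct α g m)
    (fun g h m => contr_add g h (α m))
    (fun c h m => contr_smul c h (α m))
    (fun _ m n => map_add _ m n)
    (fun c _ m => map_smul _ c m)

@[simp] theorem dualActₗ_apply (α : M →ₗ[R] M ⊗[R] A) (g : DualAlg R A) (m : M) :
    dualActₗ α g m = dualAct α g m := rfl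

theorem contr_rTensor (f : M →ₗ[R] N) (g : DualAlg R A) (t : M ⊗[R] A) :
    contr N g (f.rTensor A t) = f (contr M g t) := by
  induction t with
  | zero => simp
  | tmul m a => simp
  | add x y hx hy => simp only [map_add, hx, hy]

theorem isComodule_comul : IsComodule (comul (R := R) (A := A)) where
  coassoc := Coalgebra.coassoc
  counit_id a := by
    rw [Coalgebra.lTensor_counit_comul]
    simp

theorem IsComodule.dualAct_one {α : M →ₗ[R] M ⊗[R] A} (hα : IsComodule α) (m : M) :
    dualAct α 1 m = m := hα.counit_id m

theorem contr_tmul_one_mul {B : Type*} [CommRing B] [Algebra R B] (h : DualAlg R A) (x : B)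
    (t : B ⊗[R] A) : contr B h (x ⊗ₜ[R] (1 : A) * t) = x * contr B h t := by
  induction t with
  | zero => simp
  | tmul y a => simp
  | add y z hy hz => simp only [map_add, mul_add, hy, hz]

theorem contr_one_tmul_mul {B : Type*} [CommRing B] [Algebra R B] (h : DualAlg R A) (c : A)
    (t : B ⊗[R] A) : contr B h ((1 : B) ⊗ₜ[R] c * t) =
      contr B (toConv (h.ofConv ∘ₗ LinearMap.mulLeft R c)) t := by
  induction t with
  | zero => simp
  | tmul y a => simp
  | add y z hy hz => simp only [map_add, mul_add, hy, hz]

theorem mul_ofConv (g h : DualAlg R A) (a : A) :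
    (g * h).ofConv a = g.ofConv (dualAct (comul (R := R)) h a) := by
  change LinearMap.mul' R R (TensorProduct.map g.ofConv h.ofConv (comul (R := R) a)) =
    g.ofConv (contr A h (comul a))
  generalize comul (R := R) a = t
  induction t with
  | zero => simp
  | tmul x y => simp [mul_comm]
  | add x y hx hy => simp only [map_add, hx, hy]

/-- The contraction of a tensor in `M ⊗ A ⊗ A`. -/
theorem contr_contr (g h : DualAlg R A) (t : (M ⊗[R] A) ⊗[R] A) :
    contr M g (contr (M ⊗[R] A) h t) = (TensorProduct.rid R M) ((LinearMap.mul' R R ∘ₗ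
      TensorProduct.map g.ofConv h.ofConv).lTensor M (TensorProduct.assoc R M A A t)) := by
  induction t with
  | zero => simp
  | tmul x b =>
    induction x with
    | zero => simp
    | tmul m a => simp [smul_smul, mul_comm]
    | add x y hx hy =>
      simp only [map_add, TensorProduct.add_tmul, hx, hy]
  | add x y hx hy => simp only [map_add, hx, hy]

theorem IsComodule.dualAct_mul {α : M →ₗ[R] M ⊗[R] A} (hα : IsComodule α) (g h : DualAlg R A)
    (m : M) : dualAct α (g * h) m = dualAct α g (dualAct α h m) := by
  have h1 : dualAct α g (dualAct α h m) = contr M g (contr (M ⊗[R] A) h (α.rTensor A (α m))) := by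
    rw [contr_rTensor]; rfl
  have h2 := LinearMap.congr_fun hα.coassoc m
  simp only [LinearMap.comp_apply, LinearEquiv.coe_coe] at h2
  rw [h1, contr_contr, h2, ← LinearMap.lTensor_comp_apply]
  rfl

/-- `β (g n) = ∑ n₍₀₎ ⊗ g n₍₁₎`. -/
theorem IsComodule.coaction_dualAct {α : M →ₗ[R] M ⊗[R] A} (hα : IsComodule α) (g : DualAlg R A)
    (m : M) : α (dualAct α g m) = (dualAct (comul (R := R) (A := A)) g).lTensor M (α m) := by
  have h2 := LinearMap.congr_fun hα.coassoc m
  simp only [LinearMap.comp_apply, LinearEquiv.coe_coe] at h2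
  have h1 : α (dualAct α g m) = contr (M ⊗[R] A) g (α.rTensor A (α m)) := by
    rw [contr_rTensor]; rfl
  have h3 : ∀ t : (M ⊗[R] A) ⊗[R] A, contr (M ⊗[R] A) g t =
      (contr A g).lTensor M (TensorProduct.assoc R M A A t) := by
    intro t
    induction t with
    | zero => simp
    | tmul x b =>
      induction x with
      | zero => simp
      | tmul m a => simp
      | add x y hx hy => simp only [map_add, TensorProduct.add_tmul, hx, hy]
    | add x y hx hy => simp only [map_add, hx, hy]
  rw [h1, h3, h2, ← LinearMap.lTensor_comp_apply]
  rfl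

theorem sum_contr_basis {ι : Type*} [Fintype ι] (b : Module.Basis ι R A) (t : M ⊗[R] A) :
    ∑ i, contr M (toConv (b.coord i)) t ⊗ₜ[R] b i = t := by
  induction t with
  | zero => simp
  | tmul m a =>
    conv_rhs => rw [← b.sum_repr a, TensorProduct.tmul_sum]
    simp [TensorProduct.smul_tmul']
  | add x y hx hy => simp only [map_add, TensorProduct.add_tmul, Finset.sum_add_distrib, hx, hy]

/-- The functionals on `A` separate the elements of `M ⊗ A`. -/
theorem contr_ext [Module.Finite R A] [Module.Free R A] {t t' : M ⊗[R] A}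
    (h : ∀ g : DualAlg R A, contr M g t = contr M g t') : t = t' := by
  rw [← sum_contr_basis (Module.Free.chooseBasis R A) t,
    ← sum_contr_basis (Module.Free.chooseBasis R A) t']
  simp only [h]

/-- Tested against pairs of functionals, coassociativity becomes associativity of the product of
`A^D`. -/
theorem isComodule_regularCoaction [Module.Finite R A] [Module.Projective R A]
    [Module.Free R A] : IsComodule (regularCoaction (R := R) (A := A)) where
  coassoc := by
    ext1 f
    apply (TensorProduct.assoc R (DualAlg R A) A A).symm.injective
    refine contr_ext fun h => contr_ext fun g => ?_
    simp only [LinearMap.comp_apply, LinearEquiv.coe_coe, LinearEquiv.symm_apply_apply]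
    rw [contr_rTensor, contr_contr]
    simp only [LinearEquiv.apply_symm_apply]
    rw [← LinearMap.lTensor_comp_apply]
    have h1 := dualAct_regularCoaction (R := R) (A := A)
    calc dualAct regularCoaction g (dualAct regularCoaction h f) =
        dualAct regularCoaction (g * h) f := by simp only [h1, mul_assoc]
      _ = _ := rfl
  counit_id f := (dualAct_regularCoaction 1 f).trans (one_mul f)

end DualAction

/-! ### The projection onto integrals -/

section Integrals

open Coalgebra Bialgebra HopfAlgebra WithConv

variable {R : Type*} [CommRing R] {A : Type*} [CommRing A] [HopfAlgebra R A]

/-- `a (h x) = ∑ ⟨h, S(a₍₂₎) ·⟩ (a₍₁₎ x)`. -/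
theorem mul_dualAct_comul {a : A} {ι : Type*} (𝓡 : Coalgebra.Repr R a ι) (h : DualAlg R A)
    (x : A) : a * dualAct (comul (R := R)) h x = ∑ i ∈ 𝓡.index, dualAct (comul (R := R))
      (toConv (h.ofConv ∘ₗ LinearMap.mulLeft R (antipode R (𝓡.right i)))) (𝓡.left i * x) := by
  simp only [dualAct_apply, ← contr_one_tmul_mul, ← map_sum, comul_mul]
  rw [← contr_tmul_one_mul, ← sum_comul_mul_antipode 𝓡, Finset.sum_mul]
  congr 1
  exact Finset.sum_congr rfl fun i _ => by ring

variable {ι : Type*} [Fintype ι] (b : Module.Basis ι R A)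

theorem sum_smul_coord (h : DualAlg R A) : ∑ k, h.ofConv (b k) • toConv (b.coord k) = h := by
  apply WithConv.ofConv_injective
  change (WithConv.linearEquiv R (A →ₗ[R] R)) _ = (WithConv.linearEquiv R (A →ₗ[R] R)) h
  rw [map_sum]
  refine b.ext fun j => ?_
  classical
  simp

/-- Both sides evaluate `B` on the tensor in `A^D ⊗ A` that represents `f`. An operator can thus be
moved from the coordinate functionals to the basis vectors. -/
theorem sum_coord_comp {P : Type*} [AddCommGroup P] [Module R P]
    (B : DualAlg R A →ₗ[R] A →ₗ[R] P) (f : A →ₗ[R] A) :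
    ∑ j, B (toConv (b.coord j ∘ₗ f)) (b j) = ∑ j, B (toConv (b.coord j)) (f (b j)) := by
  have h1 : ∀ j, B (toConv (b.coord j ∘ₗ f)) (b j) =
      ∑ k, b.coord j (f (b k)) • B (toConv (b.coord k)) (b j) := by
    intro j
    conv_lhs => rw [← sum_smul_coord b (toConv (b.coord j ∘ₗ f))]
    simp
  have h2 : ∀ k, B (toConv (b.coord k)) (f (b k)) =
      ∑ j, b.coord j (f (b k)) • B (toConv (b.coord k)) (b j) := by
    intro k
    conv_lhs => rw [← b.sum_repr (f (b k))]
    simp only [map_sum, map_smul, Module.Basis.coord_apply]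
  simp only [h1, h2]
  exact Finset.sum_comm

/-- In `A^D ⊗ A ≃ End A`, the tensor on the left is `c ↦ ∑ S(c₍₁₎) c₍₂₎`. The antipode axiom
identifies this with `c ↦ ε(c) 1`, the map represented by `1 ⊗ 1`. -/
theorem sum_dualAntipode_mul_coord {P : Type*} [AddCommGroup P] [Module R P]
    (B : DualAlg R A →ₗ[R] A →ₗ[R] P) :
    ∑ i, ∑ j, B (dualAntipode (toConv (b.coord i)) * toConv (b.coord j)) (b j * b i) =
      B 1 1 := by
  have h1 : ∀ c : A, ∑ i, ∑ j,
      (dualAntipode (toConv (b.coord i)) * toConv (b.coord j)).ofConv c • (b j * b i) =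
        counit (R := R) c • (1 : A) := by
    intro c
    have h2 : ∀ t : A ⊗[R] A, ∑ i, ∑ j, (LinearMap.mul' R R (TensorProduct.map
        (dualAntipode (toConv (b.coord i))).ofConv (b.coord j) t)) • (b j * b i) =
        LinearMap.mul' R A ((antipode R).rTensor A t) := by
      intro t
      induction t with
      | zero => simp
      | tmul x y =>
        have hx : ∑ i, b.coord i (antipode R x) • b i = antipode R x := b.sum_repr _
        have hy : ∑ i, b.coord i y • b i = y := b.sum_repr _
        simp only [LinearMap.rTensor_tmul, LinearMap.mul'_apply]
        conv_rhs => rw [← hx, ← hy]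
        simp only [Finset.sum_mul_sum]
        refine Finset.sum_congr rfl fun i _ => Finset.sum_congr rfl fun j _ => ?_
        simp [smul_smul, mul_comm]
      | add x y hx hy => simp only [map_add, add_smul, Finset.sum_add_distrib, hx, hy]
    rw [← Algebra.algebraMap_eq_smul_one, ← mul_antipode_rTensor_comul_apply]
    exact h2 _
  have h3 : ∀ i j, B (dualAntipode (toConv (b.coord i)) * toConv (b.coord j)) (b j * b i) =
      ∑ k, B (toConv (b.coord k))
        ((dualAntipode (toConv (b.coord i)) * toConv (b.coord j)).ofConv (b k) • (b j * b i)) := by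
    intro i j
    conv_lhs => rw [← sum_smul_coord b (dualAntipode (toConv (b.coord i)) * toConv (b.coord j))]
    simp only [map_sum, map_smul, LinearMap.sum_apply, LinearMap.smul_apply]
  have h4 : ∑ i, ∑ j, ∑ k, B (toConv (b.coord k))
        ((dualAntipode (toConv (b.coord i)) * toConv (b.coord j)).ofConv (b k) • (b j * b i)) =
      ∑ k, B (toConv (b.coord k)) (∑ i, ∑ j,
        (dualAntipode (toConv (b.coord i)) * toConv (b.coord j)).ofConv (b k) • (b j * b i)) := by
    simp only [map_sum]
    exact (Finset.sum_congr rfl fun i _ => Finset.sum_comm).trans Finset.sum_comm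
  simp only [h3]
  rw [h4]
  simp only [h1]
  conv_rhs => rw [← sum_smul_coord b 1]
  simp

/-- The projection of `A` to its integrals: `x ↦ ∑ (e_j x)₍₁₎ ⟨e^j, (e_j x)₍₂₎⟩` for dual bases
`e_j` and `e^j`. -/
noncomputable def toIntegrals : A →ₗ[R] A :=
  ∑ j, dualAct (comul (R := R)) (toConv (b.coord j)) ∘ₗ LinearMap.mulLeft R (b j)

theorem toIntegrals_apply (x : A) : toIntegrals b x =
    ∑ j, dualAct (comul (R := R)) (toConv (b.coord j)) (b j * x) := by
  simp [toIntegrals]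

/-- Multiplication by `a` puts `S(a₍₂₎)` into the coordinate functionals. `sum_coord_comp` moves it
onto the basis vectors, where it meets `a₍₁₎` and `∑ a₍₁₎ S(a₍₂₎)` collapses to `ε(a)`. -/
theorem toIntegrals_mem (x : A) : toIntegrals b x ∈ integrals R A := by
  intro a
  let 𝓡 := Coalgebra.Repr.arbitrary R a
  rw [toIntegrals_apply, Finset.mul_sum]
  simp only [mul_dualAct_comul 𝓡]
  rw [Finset.sum_comm]
  have h1 : ∀ i, ∑ j, dualAct (comul (R := R)) (toConv ((toConv (b.coord j)).ofConv ∘ₗ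
      LinearMap.mulLeft R (antipode R (𝓡.right i)))) (𝓡.left i * (b j * x)) =
      ∑ j, dualAct (comul (R := R)) (toConv (b.coord j))
        (𝓡.left i * (antipode R (𝓡.right i)) * (b j * x)) := by
    intro i
    refine (sum_coord_comp b ((dualActₗ (comul (R := R))).compl₂
      (LinearMap.mulLeft R (𝓡.left i) ∘ₗ LinearMap.mulRight R x))
      (LinearMap.mulLeft R (antipode R (𝓡.right i)))).trans ?_
    simp [mul_assoc]
  simp only [h1]
  rw [Finset.sum_comm, Finset.smul_sum]
  refine Finset.sum_congr rfl fun j _ => ?_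
  rw [← map_sum, ← Finset.sum_mul, sum_mul_antipode_eq_smul 𝓡]
  simp

/-- This is the fundamental theorem of Hopf modules in explicit form: the integrals generate `A`
over `A^D`. -/
theorem sum_dualAct_toIntegrals (x : A) : ∑ i, dualAct (comul (R := R))
    (dualAntipode (toConv (b.coord i))) (toIntegrals b (b i * x)) = x := by
  simp only [toIntegrals_apply, map_sum, ← isComodule_comul.dualAct_mul]
  have h := sum_dualAntipode_mul_coord b ((dualActₗ (comul (R := R))).compl₂
      (LinearMap.mulRight R x))
  simp only [LinearMap.compl₂_apply, dualActₗ_apply, LinearMap.mulRight_apply, one_mul,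
    isComodule_comul.dualAct_one, mul_assoc] at h
  exact h

end Integrals

/-! ### The Frobenius structure given by a generating integral -/

section Generator

open Coalgebra Bialgebra HopfAlgebra WithConv

variable {R : Type*} [CommRing R] {A : Type*} [CommRing A] [HopfAlgebra R A]
  {θ : A}

theorem IsIntegralGenerator.mul_eq (hθ : IsIntegralGenerator R θ) (a : A) :
    a * θ = counit (R := R) a • θ := by
  have h : θ ∈ integrals R A := hθ ▸ Submodule.mem_span_singleton_self θ
  exact h a

variable [Module.Finite R A] [Module.Free R A]

/-- A generator of the integrals makes `A` a Frobenius algebra, with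
`x = ∑ θ₍₁₎ ⟨p, S(θ₍₂₎) x⟩`. -/
theorem IsIntegralGenerator.exists_frobenius (hθ : IsIntegralGenerator R θ) :
    ∃ p : A →ₗ[R] R, ∀ x : A, dualAct (comul (R := R))
      (dualAntipode (toConv (p ∘ₗ LinearMap.mulRight R x))) θ = x := by
  let b := Module.Free.chooseBasis R A
  let P : A →ₗ[R] Submodule.span R {θ} := (toIntegrals b).codRestrict _ fun x => by
    rw [show Submodule.span R {θ} = integrals R A from hθ]
    exact toIntegrals_mem b x
  -- `A` is projective, so the projection onto `Rθ` lifts through `R → Rθ`; the lift `p` is the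
  -- Frobenius functional.
  obtain ⟨p, hp⟩ := Module.projective_lifting_property
    (LinearMap.toSpanSingleton R (Submodule.span R {θ})
      ⟨θ, Submodule.mem_span_singleton_self θ⟩) P (by
      rintro ⟨y, hy⟩
      obtain ⟨c, rfl⟩ := Submodule.mem_span_singleton.mp hy
      exact ⟨c, rfl⟩)
  have hp' : ∀ x, toIntegrals b x = p x • θ := fun x =>
    (congrArg Subtype.val (LinearMap.congr_fun hp x)).symm
  refine ⟨p, fun x => ?_⟩
  have h1 := sum_smul_coord b (toConv (p ∘ₗ LinearMap.mulRight R x))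
  rw [← h1]
  refine Eq.trans ?_ (sum_dualAct_toIntegrals b x)
  simp only [hp', map_sum, map_smul]
  rw [← dualActₗ_apply, map_sum, LinearMap.sum_apply]
  simp

/-- Surjectivity is the Frobenius formula. Injectivity follows because `A` and `A^D` are isomorphic
finite modules, and a surjective endomorphism of a finite module is injective. -/
theorem IsIntegralGenerator.bijective (hθ : IsIntegralGenerator R θ) :
    Function.Bijective fun g : DualAlg R A => dualAct (comul (R := R)) g θ := by
  obtain ⟨p, hp⟩ := hθ.exists_frobenius
  have hs : Function.Surjective ((dualActₗ (comul (R := R) (A := A))).flip θ) := fun x => ⟨_, hp x⟩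
  let e : A ≃ₗ[R] DualAlg R A :=
    (Module.Free.chooseBasis R A).toDualEquiv.trans (WithConv.linearEquiv R (A →ₗ[R] R)).symm
  have h := OrzechProperty.injective_of_surjective_endomorphism
    ((dualActₗ (comul (R := R) (A := A))).flip θ ∘ₗ e.toLinearMap) (hs.comp e.surjective)
  refine ⟨fun g g' hg => ?_, hs⟩
  apply e.symm.injective
  apply h
  simpa using! hg

/-- Evaluate `∑ p(θ θ₍₁₎) p(S(θ₍₂₎) a)` in two ways. The Frobenius formula gives `p(θ a)`, while `θ
θ₍₁₎ = ε(θ₍₁₎) θ` and `p(θ) = 1` give `p(S(θ) a)`. The Frobenius formula also shows that an element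
`x` with `p(x a) = 0` for all `a` is zero. -/
theorem IsIntegralGenerator.antipode_eq (hθ : IsIntegralGenerator R θ) : antipode R θ = θ := by
  obtain ⟨p, hp⟩ := hθ.exists_frobenius
  have hp1 : p θ = 1 := by
    have h1 : dualAntipode (toConv (p ∘ₗ LinearMap.mulRight R θ)) = 1 :=
      hθ.bijective.1 ((hp θ).trans (isComodule_comul.dualAct_one θ).symm)
    have h2 := congrArg (fun g : DualAlg R A => g.ofConv 1) h1
    simpa [dual_one_apply] using h2
  have key : ∀ (y a : A) (t : A ⊗[R] A),
      p (LinearMap.mul' R A (TensorProduct.map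
        (Algebra.linearMap R A ∘ₗ p ∘ₗ LinearMap.mulLeft R y) (antipode R) t) * a) =
      p (y * contr A (dualAntipode (toConv (p ∘ₗ LinearMap.mulRight R a))) t) := by
    intro y a t
    induction t with
    | zero => simp
    | tmul u v => simp [Algebra.algebraMap_eq_smul_one, mul_comm]
    | add u v hu hv => simp only [map_add, add_mul, mul_add, hu, hv]
  have key2 : ∀ t : A ⊗[R] A, LinearMap.mul' R A (TensorProduct.map
      (Algebra.linearMap R A ∘ₗ p ∘ₗ LinearMap.mulLeft R θ) (antipode R) t) =
      antipode R (TensorProduct.lid R A (counit.rTensor A t)) := by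
    intro t
    induction t with
    | zero => simp
    | tmul u v => simp [Algebra.algebraMap_eq_smul_one, mul_comm θ u, hθ.mul_eq u, hp1]
    | add u v hu hv => simp only [map_add, hu, hv]
  have h3 : ∀ a, p ((antipode R θ - θ) * a) = 0 := by
    intro a
    have h4 := key θ a (comul θ)
    rw [key2, rTensor_counit_comul, ← dualAct_apply, hp a] at h4
    simp only [TensorProduct.lid_tmul, one_smul] at h4
    rw [sub_mul, map_sub, h4, sub_self]
  have h5 : p ∘ₗ LinearMap.mulRight R (antipode R θ - θ) = 0 := by
    ext a
    simpa [mul_comm] using h3 a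
  have h6 := hp (antipode R θ - θ)
  rw [h5] at h6
  rw [← sub_eq_zero, ← h6, ← dualActₗ_apply]
  simp

end Generator

/-! ### The form `κ` -/

section UnitForm

open Coalgebra Bialgebra HopfAlgebra WithConv

variable {R : Type*} [CommRing R] {A : Type*} [CommRing A] [HopfAlgebra R A] {θ : A}

theorem unitForm_apply (u v : DualAlg R A) :
    unitForm θ u v = (dualAntipode u * v).ofConv θ := rfl

theorem unitForm_eq_dualAct (u v : DualAlg R A) :
    unitForm θ u v = (dualAntipode u).ofConv (dualAct (comul (R := R)) v θ) :=
  mul_ofConv _ _ _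

variable [Module.Finite R A] [Module.Free R A]

theorem IsIntegralGenerator.isSymmetricBundle_unitForm (hθ : IsIntegralGenerator R θ) :
    IsSymmetricBundle (unitForm (R := R) θ) where
  finite := Module.Finite.equiv (WithConv.linearEquiv R (A →ₗ[R] R)).symm
  projective := Module.Projective.of_equiv (WithConv.linearEquiv R (A →ₗ[R] R)).symm
  symm u v := by
    rw [unitForm_apply, unitForm_apply]
    conv_lhs => rw [← hθ.antipode_eq, ← dualAntipode_apply, dualAntipode_mul,
      dualAntipode_dualAntipode]
  nondegenerate := by
    let F : DualAlg R A ≃ₗ[R] A :=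
      LinearEquiv.ofBijective ((dualActₗ (comul (R := R) (A := A))).flip θ) hθ.bijective
    have hF : ∀ v, F v = dualAct (comul (R := R)) v θ := fun v => rfl
    constructor
    · intro u u' h
      rw [← dualAntipode_dualAntipode u, ← dualAntipode_dualAntipode u']
      congr 1
      apply WithConv.ofConv_injective
      ext a
      have h1 := LinearMap.congr_fun h (F.symm a)
      rw [unitForm_eq_dualAct, unitForm_eq_dualAct, ← hF] at h1
      simpa using h1
    · intro φ
      refine ⟨dualAntipode (toConv (φ ∘ₗ F.symm.toLinearMap)), LinearMap.ext fun v => ?_⟩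
      rw [unitForm_eq_dualAct, dualAntipode_dualAntipode, ← hF]
      simp

theorem IsIntegralGenerator.isEquivariantSymmetricBundle_unitForm
    (hθ : IsIntegralGenerator R θ) :
    IsEquivariantSymmetricBundle regularCoaction (unitForm (R := R) θ) where
  isSymmetricBundle := hθ.isSymmetricBundle_unitForm
  isComodule := isComodule_regularCoaction
  equivariant g m n := by
    simp only [dualAct_regularCoaction, unitForm_apply, dualAntipode_mul, mul_assoc]

end UnitForm

/-! ### The dual integral, Casimir elements and traces -/

section DualIntegral

open Coalgebra Bialgebra HopfAlgebra WithConv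

variable {R : Type*} [CommRing R] {A : Type*} [CommRing A] [HopfAlgebra R A] {θ : A}
  {ψ : DualAlg R A}

theorem apply_eq_one_of_dualAct_eq_one (hψ : dualAct (comul (R := R)) ψ θ = 1) :
    ψ.ofConv θ = 1 := by
  have h := mul_ofConv 1 ψ θ
  rw [hψ, one_mul, dual_one_apply, counit_one] at h
  exact h

variable [Module.Finite R A] [Module.Free R A]

/-- Both sides send `θ` to `⟨h, 1⟩ 1`, and an element of `A^D` is determined by its effect on `θ`.
-/
theorem IsIntegralGenerator.mul_dual (hθ : IsIntegralGenerator R θ)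
    (hψ : dualAct (comul (R := R)) ψ θ = 1) (h : DualAlg R A) :
    h * ψ = h.ofConv 1 • ψ := by
  apply hθ.bijective.1
  change dualAct (comul (R := R)) (h * ψ) θ = dualActₗ (comul (R := R)) (h.ofConv 1 • ψ) θ
  rw [isComodule_comul.dualAct_mul, map_smul, LinearMap.smul_apply, dualActₗ_apply, hψ,
    dualAct_apply, comul_one, Algebra.TensorProduct.one_def, contr_tmul]

variable {B : Type*} [CommRing B] [Algebra R B] {α : B →ₐ[R] B ⊗[R] A}

/-- The map `b ⊗ b' ↦ (b ⊗ 1) α(b')`. -/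
noncomputable abbrev torsorMap (α : B →ₐ[R] B ⊗[R] A) : B ⊗[R] B →ₐ[B] B ⊗[R] A :=
  Algebra.TensorProduct.lift (Algebra.TensorProduct.includeLeft : B →ₐ[B] B ⊗[R] A) α
      (fun _ _ => Commute.all _ _)

omit [Module.Finite R A] [Module.Free R A] in
/-- A tensor `∑ x ⊗ y` with `∑ (x ⊗ 1) α(y) = 1 ⊗ θ` is a Casimir element for the trace-like
functional given by the dual integral. -/
theorem IsComodule.casimir (hα : IsComodule α.toLinearMap)
    (hθ : ∀ a : A, a * θ = counit (R := R) a • θ) (hψ : ψ.ofConv θ = 1) {τ : B →ₗ[R] R}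
    (hτ : ∀ b, algebraMap R B (τ b) = dualAct α.toLinearMap ψ b)
    {C : B ⊗[R] B} (hC : torsorMap α C = 1 ⊗ₜ θ) (b : B) :
    TensorProduct.rid R B ((τ ∘ₗ LinearMap.mulRight R b).lTensor B C) = b := by
  have h1 : ∀ t : B ⊗[R] B, TensorProduct.rid R B ((τ ∘ₗ LinearMap.mulRight R b).lTensor B t) =
      contr B ψ (torsorMap α t * α b) := by
    intro t
    induction t with
    | zero => simp
    | tmul x y =>
      have h2 : contr B ψ (α y * α b) = algebraMap R B (τ (y * b)) := by
        rw [hτ, ← map_mul]; rfl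
      simp only [torsorMap, Algebra.TensorProduct.lift_tmul,
        Algebra.TensorProduct.includeLeft_apply, mul_assoc, contr_tmul_one_mul, h2]
      simp [Algebra.smul_def, mul_comm]
    | add x y hx hy => simp only [map_add, add_mul, hx, hy]
  -- Since `θ a = ε(a) θ` and `ψ(θ) = 1`, the functional `ψ(θ ·)` is the counit, which acts on `B`
  -- as the identity.
  have h2 : toConv (ψ.ofConv ∘ₗ LinearMap.mulLeft R θ) = 1 := by
    apply WithConv.ofConv_injective
    ext a
    rw [dual_one_apply]
    simp [mul_comm θ a, hθ, hψ]
  rw [h1, hC, contr_one_tmul_mul, h2]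
  exact hα.dualAct_one b

/-- For `C = ∑ x ⊗ y`, the hypothesis writes multiplication by `b` as the sum of rank-one maps `z ↦
τ(b y z) x`. Its trace is therefore `∑ τ(b y x)`. -/
theorem trace_eq_of_casimir [Module.Finite R B] [Module.Free R B] {τ : B →ₗ[R] R}
    {C : B ⊗[R] B}
    (hC : ∀ b, TensorProduct.rid R B ((τ ∘ₗ LinearMap.mulRight R b).lTensor B C) = b) (b : B) :
    Algebra.trace R B b = τ (b * LinearMap.mul' R B C) := by
  let G : B →ₗ[R] Module.Dual R B :=
    LinearMap.compr₂ (LinearMap.mul R B) τ ∘ₗ LinearMap.mulLeft R b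
  have hG : ∀ y z, G y z = τ (b * y * z) := fun _ _ => rfl
  have h1 : ∀ t : B ⊗[R] B, ∀ z, dualTensorHom R B B (TensorProduct.comm R B _ (G.lTensor B t)) z =
      TensorProduct.rid R B ((τ ∘ₗ LinearMap.mulRight R (b * z)).lTensor B t) := by
    intro t z
    induction t with
    | zero => simp
    | tmul x y => simp [hG, mul_comm, mul_left_comm]
    | add x y hx hy => simp only [map_add, LinearMap.add_apply, hx, hy]
  have h2 : LinearMap.mulLeft R b = dualTensorHom R B B (TensorProduct.comm R B _ (G.lTensor B C)) := by
    ext z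
    rw [h1, hC]
    rfl
  rw [Algebra.trace_apply]
  change LinearMap.trace R B (LinearMap.mulLeft R b) = _
  rw [h2, LinearMap.trace_eq_contract_apply]
  generalize C = t
  induction t with
  | zero => simp
  | tmul x y => simp [hG, mul_comm, mul_left_comm]
  | add x y hx hy => simp only [map_add, mul_add, hx, hy]

omit [Module.Finite R A] [Module.Free R A] in
-- Applying the counit to the second factor of `∑ (x ⊗ 1) α(y) = 1 ⊗ θ` leaves `∑ x y` on the left.
theorem IsComodule.mul'_casimir (hα : IsComodule α.toLinearMap)
    {C : B ⊗[R] B} (hC : torsorMap α C = 1 ⊗ₜ θ) :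
    LinearMap.mul' R B C = algebraMap R B (counit θ) := by
  have h1 : ∀ t : B ⊗[R] B, LinearMap.mul' R B t = contr B 1 (torsorMap α t) := by
    intro t
    induction t with
    | zero => simp
    | tmul x y =>
      simp only [torsorMap, Algebra.TensorProduct.lift_tmul,
        Algebra.TensorProduct.includeLeft_apply, contr_tmul_one_mul]
      rw [show contr B 1 (α y) = y from hα.dualAct_one y]
      simp
    | add x y hx hy => simp only [map_add, hx, hy]
  rw [h1, hC, contr_tmul, dual_one_apply, Algebra.algebraMap_eq_smul_one]

omit [Module.Finite R A] [Module.Free R A] in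
theorem IsComodule.trace_eq [Module.Finite R B] [Module.Free R B] (hα : IsComodule α.toLinearMap)
    (hθ : ∀ a : A, a * θ = counit (R := R) a • θ)
    (hψ : ψ.ofConv θ = 1) {τ : B →ₗ[R] R}
    (hτ : ∀ b, algebraMap R B (τ b) = dualAct α.toLinearMap ψ b)
    {C : B ⊗[R] B} (hC : torsorMap α C = 1 ⊗ₜ θ) (b : B) :
    Algebra.trace R B b = counit θ * τ b := by
  rw [trace_eq_of_casimir (hα.casimir hθ hψ hτ hC), hα.mul'_casimir hC, mul_comm,
    ← Algebra.smul_def, map_smul, smul_eq_mul]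

theorem IsIntegralGenerator.dualAct_dual (hθ : IsIntegralGenerator R θ)
    (hψ : dualAct (comul (R := R)) ψ θ = 1) (a : A) :
    dualAct (comul (R := R)) ψ a = algebraMap R A (ψ.ofConv a) := by
  rw [← sub_eq_zero, ← Module.forall_dual_apply_eq_zero_iff R]
  intro f
  have h := mul_ofConv (toConv f) ψ a
  rw [hθ.mul_dual hψ] at h
  rw [map_sub, sub_eq_zero, Algebra.algebraMap_eq_smul_one, map_smul]
  refine (show _ = _ from h).symm.trans ?_
  simp [mul_comm]

/-- The coaction `Δ` makes `A` a torsor over itself. Its Casimir element is explicit, namely `∑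
S(θ₍₁₎) ⊗ θ₍₂₎`. -/
theorem IsIntegralGenerator.trace_eq (hθ : IsIntegralGenerator R θ)
    (hψ : dualAct (comul (R := R)) ψ θ = 1) (a : A) :
    Algebra.trace R A a = counit θ * ψ.ofConv a := by
  refine isComodule_comul.trace_eq (α := comulAlgHom R A) hθ.mul_eq
    (apply_eq_one_of_dualAct_eq_one hψ)
    (τ := ψ.ofConv) (fun b => (hθ.dualAct_dual hψ b).symm)
    (C := TensorProduct.map (antipode R) LinearMap.id (comul θ)) ?_ a
  let 𝓡 := Coalgebra.Repr.arbitrary R θ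
  rw [← sum_antipode_mul_comul 𝓡]
  conv_lhs => rw [← 𝓡.eq]
  simp only [map_sum, TensorProduct.map_tmul, Algebra.TensorProduct.lift_tmul,
    Algebra.TensorProduct.includeLeft_apply, LinearMap.id_apply, comulAlgHom_apply]

/-- `ε(θ) ψ` is the trace of `A`, which the automorphism `S` preserves, and `ε(θ)` can be cancelled
in a domain. -/
theorem IsIntegralGenerator.dualAntipode_dual [IsDomain R] (hθ : IsIntegralGenerator R θ)
    (hψ : dualAct (comul (R := R)) ψ θ = 1) (h0 : counit (R := R) θ ≠ 0) :
    dualAntipode ψ = ψ := by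
  apply WithConv.ofConv_injective
  ext a
  rw [dualAntipode_apply]
  apply mul_left_cancel₀ h0
  rw [← hθ.trace_eq hψ, ← hθ.trace_eq hψ]
  let e : A ≃ₐ[R] A := AlgEquiv.ofAlgHom (antipodeAlgHom R A) (antipodeAlgHom R A)
    (AlgHom.ext antipode_antipode) (AlgHom.ext antipode_antipode)
  exact Algebra.trace_eq_of_algEquiv e a

omit [Module.Finite R A] [Module.Free R A] in
/-- The adjunction `⟨ψ, a (g b)⟩ = ⟨ψ, (S(g) a) b⟩` for a right integral `ψ`. -/
theorem dual_mul_dualAct (hψ : ∀ h : DualAlg R A, ψ * h = h.ofConv 1 • ψ) (g : DualAlg R A)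
    (a b : A) : ψ.ofConv (a * dualAct (comul (R := R)) g b) =
      ψ.ofConv (dualAct (comul (R := R)) (dualAntipode g) a * b) := by
  have h1 : ∀ c x, (LinearMap.mul' R R) (TensorProduct.map ψ.ofConv g.ofConv
      (comul (R := R) x * (1 : A) ⊗ₜ[R] c)) = g.ofConv c * ψ.ofConv x := by
    intro c x
    have h2 : (ψ * toConv (g.ofConv ∘ₗ LinearMap.mulRight R c)).ofConv x =
        g.ofConv c * ψ.ofConv x := by
      rw [hψ]; simp
    rw [← h2]
    change _ = LinearMap.mul' R R (TensorProduct.map _ _ (comul (R := R) x))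
    generalize comul (R := R) x = t
    induction t with
    | zero => simp
    | tmul x y => simp
    | add x y hx hy => simp only [map_add, add_mul, hx, hy]
  let 𝓡 := Coalgebra.Repr.arbitrary R a
  have h3 : ψ.ofConv (a * dualAct (comul (R := R)) g b) = LinearMap.mul' R R
      (TensorProduct.map ψ.ofConv g.ofConv (a ⊗ₜ[R] (1 : A) * comul (R := R) b)) := by
    rw [dualAct_apply]
    generalize comul (R := R) b = t
    induction t with
    | zero => simp
    | tmul x y => simp [mul_comm]
    | add x y hx hy => simp only [map_add, mul_add, hx, hy]
  -- Replacing `a ⊗ 1` by `∑ Δ(a₍₁₎)(1 ⊗ S(a₍₂₎))` turns `(a ⊗ 1) Δ(b)` into `∑ Δ(a₍₁₎ b)(1 ⊗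
  -- S(a₍₂₎))`, on which `h1` evaluates `ψ ⊗ g`.
  rw [h3, ← sum_comul_mul_antipode 𝓡, Finset.sum_mul, map_sum, map_sum]
  simp only [mul_right_comm _ _ (comul b), ← comul_mul, h1]
  rw [dualAct_apply]
  conv_rhs => rw [← 𝓡.eq]
  simp [Finset.sum_mul]

theorem IsIntegralGenerator.dual_mul (hθ : IsIntegralGenerator R θ)
    (hψ : dualAct (comul (R := R)) ψ θ = 1) (hS : dualAntipode ψ = ψ) (h : DualAlg R A) :
    ψ * h = h.ofConv 1 • ψ := by
  rw [← dualAntipode_dualAntipode (ψ * h), dualAntipode_mul, hS, hθ.mul_dual hψ, map_smul, hS]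
  simp

end DualIntegral

/-! ### Tensor products and transport of comodules -/

section TensorComodule

open Coalgebra Bialgebra HopfAlgebra WithConv

variable {R : Type*} [CommRing R] {A : Type*} [CommRing A] [HopfAlgebra R A]
  {M : Type*} [AddCommGroup M] [Module R M] {N : Type*} [AddCommGroup N] [Module R N]

/-- The map `(m ⊗ a) ⊗ (n ⊗ b) ↦ (m ⊗ n) ⊗ a b`. -/
noncomputable def mulRightFactors (R : Type*) [CommRing R] (M N Q : Type*) [AddCommGroup M]
    [Module R M] [AddCommGroup N] [Module R N] [CommRing Q] [Algebra R Q] :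
    (M ⊗[R] Q) ⊗[R] (N ⊗[R] Q) →ₗ[R] (M ⊗[R] N) ⊗[R] Q :=
  (LinearMap.mul' R Q).lTensor (M ⊗[R] N) ∘ₗ
    (TensorProduct.tensorTensorTensorComm R M Q N Q).toLinearMap

@[simp] theorem mulRightFactors_tmul {Q : Type*} [CommRing Q] [Algebra R Q] (m : M) (a : Q)
    (n : N) (b : Q) : mulRightFactors R M N Q ((m ⊗ₜ a) ⊗ₜ (n ⊗ₜ b)) = (m ⊗ₜ n) ⊗ₜ (a * b) := by
  simp [mulRightFactors]

theorem tensorCoaction_tmul (α : M →ₗ[R] M ⊗[R] A) (β : N →ₗ[R] N ⊗[R] A) (m : M) (n : N) :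
    tensorCoaction α β (m ⊗ₜ n) = mulRightFactors R M N A (α m ⊗ₜ β n) := rfl

/-- Linear maps on `(M ⊗ P) ⊗ (N ⊗ Q)` are determined by their values on pure tensors. -/
theorem tmul_induction {P Q : Type*} [AddCommMonoid P] [Module R P] [AddCommMonoid Q] [Module R Q]
    {X : Type*} [AddCommMonoid X] [Module R X]
    {f g : (M ⊗[R] P) ⊗[R] (N ⊗[R] Q) →ₗ[R] X}
    (h : ∀ m p n q, f ((m ⊗ₜ p) ⊗ₜ (n ⊗ₜ q)) = g ((m ⊗ₜ p) ⊗ₜ (n ⊗ₜ q))) (t : M ⊗[R] P)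
    (u : N ⊗[R] Q) : f (t ⊗ₜ u) = g (t ⊗ₜ u) := by
  have h1 : f = g := by
    ext m p n q
    exact h m p n q
  rw [h1]

theorem isComodule_tensorCoaction {α : M →ₗ[R] M ⊗[R] A} {β : N →ₗ[R] N ⊗[R] A}
    (hα : IsComodule α) (hβ : IsComodule β) : IsComodule (tensorCoaction α β) where
  coassoc := by
    refine TensorProduct.ext' fun m n => ?_
    have h1 : ∀ t u, (tensorCoaction α β).rTensor A (mulRightFactors R M N A (t ⊗ₜ u)) =
        (mulRightFactors R M N A).rTensor A
          (mulRightFactors R (M ⊗[R] A) (N ⊗[R] A) A (α.rTensor A t ⊗ₜ β.rTensor A u)) := by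
      refine tmul_induction (f := (tensorCoaction α β).rTensor A ∘ₗ mulRightFactors R M N A)
        (g := (mulRightFactors R M N A).rTensor A ∘ₗ
          mulRightFactors R (M ⊗[R] A) (N ⊗[R] A) A ∘ₗ
          TensorProduct.map (α.rTensor A) (β.rTensor A)) ?_
      intro m a n b
      simp [tensorCoaction_tmul]
    have h2 : ∀ t u, (comul (R := R) (A := A)).lTensor (M ⊗[R] N)
        (mulRightFactors R M N A (t ⊗ₜ u)) = mulRightFactors R M N (A ⊗[R] A)
          ((comul (R := R) (A := A)).lTensor M t ⊗ₜ (comul (R := R) (A := A)).lTensor N u) := by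
      refine tmul_induction
        (f := (comul (R := R) (A := A)).lTensor (M ⊗[R] N) ∘ₗ mulRightFactors R M N A)
        (g := mulRightFactors R M N (A ⊗[R] A) ∘ₗ TensorProduct.map
          ((comul (R := R) (A := A)).lTensor M) ((comul (R := R) (A := A)).lTensor N)) ?_
      intro m a n b
      simp
    have h3 : ∀ t u, TensorProduct.assoc R (M ⊗[R] N) A A ((mulRightFactors R M N A).rTensor A
          (mulRightFactors R (M ⊗[R] A) (N ⊗[R] A) A (t ⊗ₜ u))) =
        mulRightFactors R M N (A ⊗[R] A)
          (TensorProduct.assoc R M A A t ⊗ₜ TensorProduct.assoc R N A A u) := by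
      intro t u
      have h4 : (TensorProduct.assoc R (M ⊗[R] N) A A).toLinearMap ∘ₗ
          (mulRightFactors R M N A).rTensor A ∘ₗ mulRightFactors R (M ⊗[R] A) (N ⊗[R] A) A =
          mulRightFactors R M N (A ⊗[R] A) ∘ₗ TensorProduct.map
            (TensorProduct.assoc R M A A).toLinearMap
            (TensorProduct.assoc R N A A).toLinearMap := by
        ext m a a' n b b'
        simp
      exact LinearMap.congr_fun h4 (t ⊗ₜ u)
    have hα' := LinearMap.congr_fun hα.coassoc m
    have hβ' := LinearMap.congr_fun hβ.coassoc n
    simp only [LinearMap.comp_apply, LinearEquiv.coe_coe] at hα' hβ' ⊢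
    rw [tensorCoaction_tmul, h1, h2, h3, hα', hβ']
  counit_id z := by
    have h1 : ∀ t u, TensorProduct.rid R (M ⊗[R] N) ((counit (R := R) (A := A)).lTensor (M ⊗[R] N)
        (mulRightFactors R M N A (t ⊗ₜ u))) =
        TensorProduct.rid R M ((counit (R := R) (A := A)).lTensor M t) ⊗ₜ
          TensorProduct.rid R N ((counit (R := R) (A := A)).lTensor N u) := by
      refine tmul_induction
        (f := (TensorProduct.rid R (M ⊗[R] N)).toLinearMap ∘ₗ
          (counit (R := R) (A := A)).lTensor (M ⊗[R] N) ∘ₗ mulRightFactors R M N A)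
        (g := TensorProduct.map
          ((TensorProduct.rid R M).toLinearMap ∘ₗ (counit (R := R) (A := A)).lTensor M)
          ((TensorProduct.rid R N).toLinearMap ∘ₗ (counit (R := R) (A := A)).lTensor N)) ?_
      intro m a n b
      simp [TensorProduct.smul_tmul', TensorProduct.tmul_smul, smul_smul, mul_comm]
    induction z with
    | zero => simp
    | tmul m n => rw [tensorCoaction_tmul, h1, hα.counit_id, hβ.counit_id]
    | add x y hx hy => simp only [map_add, hx, hy]

theorem isComodule_conj {α : M →ₗ[R] M ⊗[R] A} (hα : IsComodule α) (σ : M ≃ₗ[R] N) :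
    IsComodule (σ.toLinearMap.rTensor A ∘ₗ α ∘ₗ σ.symm.toLinearMap) where
  coassoc := by
    ext n
    have h1 := LinearMap.congr_fun hα.coassoc (σ.symm n)
    have h2 : ∀ t : M ⊗[R] A, TensorProduct.assoc R N A A
        ((σ.toLinearMap.rTensor A ∘ₗ α ∘ₗ σ.symm.toLinearMap).rTensor A
          (σ.toLinearMap.rTensor A t)) =
        σ.toLinearMap.rTensor (A ⊗[R] A) (TensorProduct.assoc R M A A (α.rTensor A t)) := by
      intro t
      induction t with
      | zero => simp
      | tmul m a =>
        simp only [LinearMap.rTensor_tmul, LinearMap.comp_apply, LinearEquiv.coe_coe,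
          LinearEquiv.symm_apply_apply]
        generalize α m = u
        induction u with
        | zero => simp
        | tmul m b => simp
        | add x y hx hy => simp only [map_add, TensorProduct.add_tmul, hx, hy]
      | add x y hx hy => simp only [map_add, hx, hy]
    simp only [LinearMap.comp_apply, LinearEquiv.coe_coe] at h1 h2 ⊢
    rw [h2, h1]
    generalize α (σ.symm n) = u
    induction u with
    | zero => simp
    | tmul m b => simp
    | add x y hx hy => simp only [map_add, hx, hy]
  counit_id n := by
    have h1 := hα.counit_id (σ.symm n)
    have h2 : ∀ t : M ⊗[R] A, TensorProduct.rid R N ((counit (R := R) (A := A)).lTensor N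
        (σ.toLinearMap.rTensor A t)) =
        σ (TensorProduct.rid R M ((counit (R := R) (A := A)).lTensor M t)) := by
      intro t
      induction t with
      | zero => simp
      | tmul m a => simp
      | add x y hx hy => simp only [map_add, hx, hy]
    simp only [LinearMap.comp_apply, LinearEquiv.coe_coe] at h2 ⊢
    rw [h2, h1, LinearEquiv.apply_symm_apply]

theorem dualAct_conj (α : M →ₗ[R] M ⊗[R] A) (σ : M ≃ₗ[R] N) (g : DualAlg R A) (n : N) :
    dualAct (σ.toLinearMap.rTensor A ∘ₗ α ∘ₗ σ.symm.toLinearMap) g n =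
      σ (dualAct α g (σ.symm n)) :=
  contr_rTensor σ.toLinearMap g (α (σ.symm n))

variable {ψ : DualAlg R A}

theorem IsComodule.dualAct_mem_fixedPoints {α : M →ₗ[R] M ⊗[R] A} (hα : IsComodule α)
    (hψ : ∀ a, dualAct (comul (R := R)) ψ a = algebraMap R A (ψ.ofConv a)) (m : M) :
    dualAct α ψ m ∈ fixedPoints α := by
  change α (dualAct α ψ m) = dualAct α ψ m ⊗ₜ (1 : A)
  rw [hα.coaction_dualAct, dualAct_apply]
  generalize α m = t
  induction t with
  | zero => simp
  | tmul m a => simp [hψ, Algebra.algebraMap_eq_smul_one, TensorProduct.smul_tmul']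
  | add x y hx hy => simp only [map_add, TensorProduct.add_tmul, hx, hy]

/-- This is the adjunction `dual_mul_dualAct` applied to the `A`-components of `α m` and `β n`. It
supplies both the equivariance of the form of `τ` and the surjectivity of the final isometry. -/
theorem dualAct_tensorCoaction_tmul_dualAct {α : M →ₗ[R] M ⊗[R] A} {β : N →ₗ[R] N ⊗[R] A}
    (hα : IsComodule α) (hβ : IsComodule β) (hψ : ∀ h : DualAlg R A, ψ * h = h.ofConv 1 • ψ)
    (g : DualAlg R A) (m : M) (n : N) :
    dualAct (tensorCoaction α β) ψ (m ⊗ₜ dualAct β g n) =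
      dualAct (tensorCoaction α β) ψ (dualAct α (dualAntipode g) m ⊗ₜ n) := by
  rw [dualAct_apply, dualAct_apply (tensorCoaction α β), tensorCoaction_tmul, tensorCoaction_tmul,
    hα.coaction_dualAct, hβ.coaction_dualAct]
  refine tmul_induction
    (f := contr (M ⊗[R] N) ψ ∘ₗ mulRightFactors R M N A ∘ₗ
      TensorProduct.map LinearMap.id ((dualAct (comul (R := R) (A := A)) g).lTensor N))
    (g := contr (M ⊗[R] N) ψ ∘ₗ mulRightFactors R M N A ∘ₗ
      TensorProduct.map ((dualAct (comul (R := R) (A := A)) (dualAntipode g)).lTensor M)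
        LinearMap.id) ?_ (α m) (β n)
  intro m a n b
  simp [dual_mul_dualAct hψ]

end TensorComodule

/-! ### Equivariant forms and the form on fixed points -/

section Forms

open Coalgebra Bialgebra HopfAlgebra WithConv

variable {R : Type*} [CommRing R] {A : Type*} [CommRing A] [HopfAlgebra R A]
  {M : Type*} [AddCommGroup M] [Module R M] {N : Type*} [AddCommGroup N] [Module R N]

/-- The form `q` is `A`-equivariant for the coaction `α`. -/
def IsEquivariantForm (α : M →ₗ[R] M ⊗[R] A) (q : LinearMap.BilinForm R M) : Prop :=
  ∀ (g : DualAlg R A) (m n : M), q (dualAct α g m) n = q m (dualAct α (dualAntipode g) n)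

/-- The contraction `m ⊗ a ↦ f(m) a`. -/
noncomputable def contrLeft (A : Type*) [CommRing A] [Algebra R A] (f : M →ₗ[R] R) :
    M ⊗[R] A →ₗ[R] A :=
  (TensorProduct.lid R A).toLinearMap ∘ₗ f.rTensor A

@[simp] theorem contrLeft_tmul (f : M →ₗ[R] R) (m : M) (a : A) :
    contrLeft A f (m ⊗ₜ[R] a) = f m • a := by
  simp [contrLeft]

theorem apply_contr (f : M →ₗ[R] R) (g : DualAlg R A) (t : M ⊗[R] A) :
    f (contr M g t) = g.ofConv (contrLeft A f t) := by
  induction t with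
  | zero => simp
  | tmul m a => simp [mul_comm]
  | add x y hx hy => simp only [map_add, hx, hy]

/-- Stripped of the functional `g`, equivariance becomes the identity `∑ q(x₍₀₎, y) x₍₁₎ = S(∑ q(x,
y₍₀₎) y₍₁₎)` in `A`. Such identities can be multiplied, because `S` is multiplicative, and this
handles tensor products. -/
theorem IsEquivariantForm.contrLeft_eq [Module.Finite R A] [Module.Free R A]
    {α : M →ₗ[R] M ⊗[R] A} {q : LinearMap.BilinForm R M} (hq : IsEquivariantForm α q) (x y : M) :
    contrLeft A (q.flip y) (α x) = antipode R (contrLeft A (q x) (α y)) := by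
  rw [← sub_eq_zero, ← Module.forall_dual_apply_eq_zero_iff R]
  intro f
  rw [map_sub, sub_eq_zero]
  refine (apply_contr (q.flip y) (toConv f) (α x)).symm.trans ?_
  exact (hq (toConv f) x y).trans (apply_contr (q x) (dualAntipode (toConv f)) (α y))

theorem contrLeft_mulRightFactors (f : M →ₗ[R] R) (f' : N →ₗ[R] R) (F : M ⊗[R] N →ₗ[R] R)
    (hF : ∀ m n, F (m ⊗ₜ n) = f m * f' n) (t : M ⊗[R] A) (u : N ⊗[R] A) :
    contrLeft A F (mulRightFactors R M N A (t ⊗ₜ u)) = contrLeft A f t * contrLeft A f' u := by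
  refine tmul_induction (f := contrLeft A F ∘ₗ mulRightFactors R M N A)
    (g := LinearMap.mul' R A ∘ₗ TensorProduct.map (contrLeft A f) (contrLeft A f')) ?_ t u
  intro m a n b
  simp [hF, smul_smul, mul_comm]

theorem IsEquivariantForm.tmul [Module.Finite R A] [Module.Free R A]
    {α : M →ₗ[R] M ⊗[R] A} {q : LinearMap.BilinForm R M} (hq : IsEquivariantForm α q)
    {β : N →ₗ[R] N ⊗[R] A} {q' : LinearMap.BilinForm R N} (hq' : IsEquivariantForm β q') :
    IsEquivariantForm (tensorCoaction α β) (LinearMap.BilinForm.tmul q q') := by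
  intro g z w
  induction z with
  | zero => simp
  | add x y hx hy => simp only [map_add, LinearMap.add_apply, hx, hy]
  | tmul m n =>
  induction w with
  | zero => simp
  | add x y hx hy => simp only [map_add, hx, hy]
  | tmul m' n' =>
  have h2 := contrLeft_mulRightFactors (q.flip m') (q'.flip n') ((LinearMap.BilinForm.tmul q q').flip (m' ⊗ₜ n'))
    (by intro m n; simp [mul_comm]) (α m) (β n)
  have h3 := contrLeft_mulRightFactors (q m) (q' n) (LinearMap.BilinForm.tmul q q' (m ⊗ₜ n))
    (by intro m n; simp [mul_comm]) (α m') (β n')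
  refine (apply_contr ((LinearMap.BilinForm.tmul q q').flip (m' ⊗ₜ n')) g _).trans ?_
  refine Eq.trans ?_ (apply_contr (LinearMap.BilinForm.tmul q q' (m ⊗ₜ n)) (dualAntipode g) _).symm
  rw [tensorCoaction_tmul, tensorCoaction_tmul, h2, h3, hq.contrLeft_eq, hq'.contrLeft_eq,
    ← antipode_mul_distrib, dualAntipode_apply]

/-- Because `S^D ψ = ψ`, the operator `ψ` is self-adjoint for `q`. So `q(m, ψ n) = q(ψ m, n)`
depends only on `ψ m` and `ψ n`, and any choice of preimages defines the form. -/
theorem IsEquivariantForm.exists_isFixedPointForm {γ : M →ₗ[R] M ⊗[R] A}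
    {q : LinearMap.BilinForm R M} (hq : IsEquivariantForm γ q) {ψ : DualAlg R A}
    (hS : dualAntipode ψ = ψ) (hr : LinearMap.range (dualAct γ ψ) = fixedPoints γ) :
    ∃ qA : LinearMap.BilinForm R (fixedPoints γ), IsFixedPointForm γ q ψ qA := by
  have hex : ∀ x : fixedPoints γ, ∃ m, dualAct γ ψ m = x := fun x => by
    have h : (x : M) ∈ LinearMap.range (dualAct γ ψ) := by rw [hr]; exact x.2
    exact h
  choose p hp using hex
  have hadj : ∀ m n, q (dualAct γ ψ m) n = q m (dualAct γ ψ n) := fun m n => by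
    rw [hq, hS]
  have hwd : ∀ (m : M) (x y : fixedPoints γ), dualAct γ ψ m = x → q (p x) y = q m y := by
    intro m x y h
    rw [← hp y, ← hadj, ← hadj, h, hp]
  refine ⟨LinearMap.mk₂ R (fun x y => q (p x) y) ?_ ?_ ?_ ?_, hr, ?_, ?_⟩
  · intro x x' y
    rw [hwd (p x + p x') (x + x') y (by simp [hp])]
    simp
  · intro c x y
    rw [hwd (c • p x) (c • x) y (by simp [hp])]
    simp
  · intro x y y'
    simp
  · intro c x y
    simp
  · intro m x y h
    exact hwd m x y h
  · intro n x y h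
    rw [LinearMap.mk₂_apply, ← h, ← hadj, hp]

end Forms

/-! ### Principal homogeneous spaces and the twist -/

section Torsors

open Coalgebra Bialgebra HopfAlgebra WithConv

variable {R : Type*} [CommRing R] {A : Type*} [CommRing A] [HopfAlgebra R A] {θ : A}
  {ψ : DualAlg R A}

section Functional

variable {B : Type*} [CommRing B] [Algebra R B]

/-- For `C = ∑ x ⊗ y`, the map `f ↦ ∑ f(y) x` is a left inverse of the adjoint. It is a surjection
from the dual of `B` to `B`, which are isomorphic finite modules, so it is also injective. -/
theorem bijective_of_casimir [Module.Finite R B] [Module.Free R B] {τ : B →ₗ[R] R}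
    {C : B ⊗[R] B}
    (hC : ∀ b, TensorProduct.rid R B ((τ ∘ₗ LinearMap.mulRight R b).lTensor B C) = b) :
    Function.Bijective ((LinearMap.mul R B).compr₂ τ : B → Module.Dual R B) := by
  have h0 : ∀ t : B ⊗[R] B, ∃ E : Module.Dual R B →ₗ[R] B,
      ∀ f, E f = TensorProduct.rid R B (f.lTensor B t) := fun t =>
    ⟨{  toFun := fun f => TensorProduct.rid R B (f.lTensor B t)
        map_add' := fun f g => by simp [LinearMap.lTensor_add]
        map_smul' := fun c f => by simp [LinearMap.lTensor_smul] }, fun f => rfl⟩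
  obtain ⟨E, hE⟩ := h0 C
  have hED : ∀ b, E ((LinearMap.mul R B).compr₂ τ b) = b := by
    intro b
    rw [hE]
    convert hC b using 3
    ext z
    simp [mul_comm]
  let e : B ≃ₗ[R] Module.Dual R B := (Module.Free.chooseBasis R B).toDualEquiv
  have hinj := OrzechProperty.injective_of_surjective_endomorphism (E ∘ₗ e.toLinearMap)
    (show Function.Surjective (E ∘ e) from
      Function.Surjective.comp (fun b => ⟨_, hED b⟩) e.surjective)
  have hEinj : Function.Injective E := by
    intro f g hfg
    apply e.symm.injective
    apply hinj
    simpa using hfg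
  exact ⟨Function.LeftInverse.injective hED, fun f => ⟨E f, hEinj (hED _)⟩⟩

/-- If `c` generates the image of `τ`, the Casimir identity at `1` shows that `c` divides `1` in
`B`. Taking norms, a positive power of `c` is a unit of `R`. -/
theorem surjective_of_casimir [IsDomain R] [IsPrincipalIdealRing R] [Nontrivial B]
    [Module.Finite R B] [Module.Free R B] {τ : B →ₗ[R] R} {C : B ⊗[R] B}
    (hC : ∀ b, TensorProduct.rid R B ((τ ∘ₗ LinearMap.mulRight R b).lTensor B C) = b) :
    ∃ b, τ b = 1 := by
  obtain ⟨c, hc⟩ := (IsPrincipalIdealRing.principal (LinearMap.range τ)).principal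
  have hdvd : ∀ b, c ∣ τ b := by
    intro b
    have h : τ b ∈ LinearMap.range τ := ⟨b, rfl⟩
    rw [hc] at h
    exact Ideal.mem_span_singleton.mp h
  have h1 : ∀ t : B ⊗[R] B, algebraMap R B c ∣
      TensorProduct.rid R B ((τ ∘ₗ LinearMap.mulRight R 1).lTensor B t) := by
    intro t
    induction t with
    | zero => simp
    | tmul x y =>
      obtain ⟨d, hd⟩ := hdvd y
      simp [hd, Algebra.smul_def, mul_assoc]
    | add x y hx hy => simp only [map_add]; exact dvd_add hx hy
  have h2 : IsUnit (algebraMap R B c) := isUnit_of_dvd_one (by simpa only [hC] using h1 C)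
  have h3 := h2.map (Algebra.norm R)
  rw [Algebra.norm_algebraMap_of_basis (Module.Free.chooseBasis R B),
    isUnit_pow_iff Fintype.card_ne_zero] at h3
  have h4 : (1 : R) ∈ LinearMap.range τ := by
    rw [hc]
    exact Ideal.mem_span_singleton.mpr h3.dvd
  exact h4

variable {α : B →ₐ[R] B ⊗[R] A}

theorem mul'_dualAct (g : DualAlg R A) (z : B ⊗[R] B) :
    LinearMap.mul' R B (dualAct (tensorCoaction α.toLinearMap α.toLinearMap) g z) =
      dualAct α.toLinearMap g (LinearMap.mul' R B z) := by
  induction z with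
  | zero => simp
  | add x y hx hy => simp only [map_add, hx, hy]
  | tmul b c =>
    rw [dualAct_apply, dualAct_apply, tensorCoaction_tmul, LinearMap.mul'_apply]
    simp only [AlgHom.toLinearMap_apply, map_mul]
    refine tmul_induction
      (f := LinearMap.mul' R B ∘ₗ contr (B ⊗[R] B) g ∘ₗ mulRightFactors R B B A)
      (g := contr B g ∘ₗ LinearMap.mul' R (B ⊗[R] A)) ?_ (α b) (α c)
    intro m a n b
    simp

variable [Module.Finite R B] [Module.Flat R B]

theorem IsPHS.exists_functional (h : IsPHS α)
    (hψ : ∀ a, dualAct (comul (R := R)) ψ a = algebraMap R A (ψ.ofConv a)) :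
    ∃ τ : B →ₗ[R] R, ∀ b, algebraMap R B (τ b) = dualAct α.toLinearMap ψ b := by
  have h1 : ∀ b, dualAct α.toLinearMap ψ b ∈ LinearMap.range (Algebra.linearMap R B) := fun b =>
    (h.fixed _).mp (h.isComodule.dualAct_mem_fixedPoints hψ b)
  let e := LinearEquiv.ofInjective (Algebra.linearMap R B) h.algebraMap_injective
  refine ⟨e.symm.toLinearMap ∘ₗ (dualAct α.toLinearMap ψ).codRestrict _ h1, fun b => ?_⟩
  have h2 := e.apply_symm_apply ((dualAct α.toLinearMap ψ).codRestrict _ h1 b)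
  exact congrArg Subtype.val h2

theorem IsPHS.exists_casimir (h : IsPHS α) (θ : A) :
    ∃ C : B ⊗[R] B, torsorMap α C = 1 ⊗ₜ θ := h.bijective.2 _

/-- Multiplication `B ⊗ B → B` commutes with `A^D`, so it carries the adjunction for `ψ` on `B ⊗ B`
to one for `τ(bc)`. -/
theorem IsPHS.functional_equivariant (h : IsPHS α)
    (hψ : ∀ h : DualAlg R A, ψ * h = h.ofConv 1 • ψ) {τ : B →ₗ[R] R}
    (hτ : ∀ b, algebraMap R B (τ b) = dualAct α.toLinearMap ψ b) :
    IsEquivariantForm α.toLinearMap ((LinearMap.mul R B).compr₂ τ) := by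
  intro g b c
  apply h.algebraMap_injective
  have h1 := dualAct_tensorCoaction_tmul_dualAct h.isComodule h.isComodule hψ (dualAntipode g) b c
  rw [dualAntipode_dualAntipode] at h1
  have h2 := congrArg (LinearMap.mul' R B) h1
  rw [mul'_dualAct, mul'_dualAct, ← hτ, ← hτ] at h2
  exact h2.symm

end Functional

section Twist

variable {B : Type*} [CommRing B] [Algebra R B] {α : B →ₐ[R] B ⊗[R] A}
  {D : Type*} [AddCommGroup D] [Module R D] (σ : B ≃ₗ[R] D)
  {M : Type*} [AddCommGroup M] [Module R M] {β : M →ₗ[R] M ⊗[R] A}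

/-- A coaction on `B`, transported along `σ`. -/
noncomputable abbrev conjCoaction (α : B →ₐ[R] B ⊗[R] A) (σ : B ≃ₗ[R] D) : D →ₗ[R] D ⊗[R] A :=
  σ.toLinearMap.rTensor A ∘ₗ α.toLinearMap ∘ₗ σ.symm.toLinearMap

/-- The multiplication `B ⊗ (D ⊗ M) → D ⊗ M`, where `B` acts on `D` through `σ`. -/
noncomputable def mulConj (M : Type*) [AddCommGroup M] [Module R M] :
    B ⊗[R] (D ⊗[R] M) →ₗ[R] D ⊗[R] M :=
  (σ.toLinearMap ∘ₗ LinearMap.mul' R B ∘ₗ σ.symm.toLinearMap.lTensor B).rTensor M ∘ₗ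
    (TensorProduct.assoc R B D M).symm.toLinearMap

@[simp] theorem mulConj_tmul (b : B) (d : D) (m : M) :
    mulConj σ M (b ⊗ₜ (d ⊗ₜ m)) = σ (b * σ.symm d) ⊗ₜ m := by
  simp [mulConj]

theorem mulConj_one_tmul (n : D ⊗[R] M) : mulConj σ M ((1 : B) ⊗ₜ n) = n := by
  induction n with
  | zero => simp
  | tmul d m => simp
  | add x y hx hy => simp only [map_add, TensorProduct.tmul_add, hx, hy]

theorem tensorCoaction_mulConj (b : B) (n : D ⊗[R] M) :
    tensorCoaction (conjCoaction α σ) β (mulConj σ M (b ⊗ₜ n)) =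
      (mulConj σ M).rTensor A (mulRightFactors R B (D ⊗[R] M) A
        (α b ⊗ₜ tensorCoaction (conjCoaction α σ) β n)) := by
  induction n with
  | zero => simp
  | add x y hx hy => simp only [map_add, TensorProduct.tmul_add, hx, hy]
  | tmul d m =>
    rw [mulConj_tmul, tensorCoaction_tmul, tensorCoaction_tmul]
    simp only [LinearMap.comp_apply, LinearEquiv.coe_coe, LinearEquiv.symm_apply_apply,
      AlgHom.toLinearMap_apply, map_mul]
    generalize α b = t
    generalize α (σ.symm d) = u
    generalize β m = v
    induction t with
    | zero => simp
    | add x y hx hy => simp only [map_add, add_mul, TensorProduct.add_tmul, hx, hy]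
    | tmul x a =>
    induction u with
    | zero => simp
    | add x y hx hy =>
      simp only [map_add, mul_add, TensorProduct.add_tmul, TensorProduct.tmul_add, hx, hy]
    | tmul y c =>
    induction v with
    | zero => simp
    | add x y hx hy => simp only [map_add, TensorProduct.tmul_add, hx, hy]
    | tmul m e => simp [mul_assoc]

/-- For a fixed point `n`, the integral acts on `b n` only through `b`, so `ψ(b n) = (ψ b) n = n`.
-/
theorem range_dualAct_tensorCoaction (hα : IsComodule α.toLinearMap) (hβ : IsComodule β)
    (hψ : ∀ a, dualAct (comul (R := R)) ψ a = algebraMap R A (ψ.ofConv a))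
    {b : B} (hb : dualAct α.toLinearMap ψ b = 1) :
    LinearMap.range (dualAct (tensorCoaction (conjCoaction α σ) β) ψ) =
      fixedPoints (tensorCoaction (conjCoaction α σ) β) := by
  apply le_antisymm
  · rintro _ ⟨n, rfl⟩
    exact (isComodule_tensorCoaction (isComodule_conj hα σ) hβ).dualAct_mem_fixedPoints hψ n
  · intro n hn
    have hn' : tensorCoaction (conjCoaction α σ) β n = n ⊗ₜ (1 : A) := hn
    have h1 : ∀ t : B ⊗[R] A, contr (B ⊗[R] (D ⊗[R] M)) ψ
        (mulRightFactors R B (D ⊗[R] M) A (t ⊗ₜ (n ⊗ₜ (1 : A)))) = contr B ψ t ⊗ₜ n := by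
      intro t
      induction t with
      | zero => simp
      | tmul x a => simp [TensorProduct.smul_tmul']
      | add x y hx hy => simp only [map_add, TensorProduct.add_tmul, hx, hy]
    refine ⟨mulConj σ M (b ⊗ₜ n), ?_⟩
    rw [dualAct_apply, tensorCoaction_mulConj, contr_rTensor, hn', h1]
    rw [show contr B ψ (α b) = 1 from hb, mulConj_one_tmul]

theorem isEquivariantForm_conj {τ : B →ₗ[R] R} {T : LinearMap.BilinForm R D}
    (hT : ∀ b c, T (σ b) (σ c) = τ (b * c))
    (hτ : IsEquivariantForm α.toLinearMap ((LinearMap.mul R B).compr₂ τ)) :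
    IsEquivariantForm (conjCoaction α σ) T := by
  intro g x y
  obtain ⟨b, rfl⟩ := σ.surjective x
  obtain ⟨c, rfl⟩ := σ.surjective y
  rw [dualAct_conj, dualAct_conj, hT, hT, σ.symm_apply_apply, σ.symm_apply_apply]
  exact hτ g b c

end Twist

section RegularTwist

variable [Module.Finite R A] [Module.Free R A]
  {D : Type*} [AddCommGroup D] [Module R D] {δ : D →ₗ[R] D ⊗[R] A}

theorem exists_dualAct_tmul_one (hδ : IsComodule δ)
    (hψ : ∀ h : DualAlg R A, ψ * h = h.ofConv 1 • ψ) (z : D ⊗[R] DualAlg R A) :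
    ∃ x : D, dualAct (tensorCoaction δ regularCoaction) ψ (x ⊗ₜ 1) =
      dualAct (tensorCoaction δ regularCoaction) ψ z := by
  induction z with
  | zero => exact ⟨0, by simp⟩
  | tmul d f =>
    refine ⟨dualAct δ (dualAntipode f) d, ?_⟩
    rw [← dualAct_tensorCoaction_tmul_dualAct hδ isComodule_regularCoaction hψ,
      dualAct_regularCoaction, mul_one]
  | add z w hz hw =>
    obtain ⟨x, hx⟩ := hz
    obtain ⟨y, hy⟩ := hw
    exact ⟨x + y, by rw [TensorProduct.add_tmul, map_add, map_add, hx, hy]⟩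

/-- Pairing the left side with a functional `f` gives `κ(1, f) = ⟨f, θ⟩`. -/
theorem contrLeft_unitForm_regularCoaction :
    contrLeft A (unitForm (R := R) θ 1) (regularCoaction 1) = θ := by
  rw [← sub_eq_zero, ← Module.forall_dual_apply_eq_zero_iff R]
  intro f
  rw [map_sub, sub_eq_zero]
  refine (apply_contr (unitForm (R := R) θ 1) (toConv f) (regularCoaction 1)).symm.trans ?_
  rw [← dualAct_apply, dualAct_regularCoaction, unitForm_apply, dualAntipode_one, one_mul, mul_one]

/-- The left side is `ψ` evaluated at `(∑ T(x, y₍₀₎) y₍₁₎) θ`. The integral property replaces the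
first factor by its counit, which is `T(x, y)`. -/
theorem tmul_unitForm_dualAct (hδ : IsComodule δ) (hθ : ∀ a : A, a * θ = counit (R := R) a • θ)
    (T : LinearMap.BilinForm R D) (x y : D) :
    LinearMap.BilinForm.tmul T (unitForm (R := R) θ) (x ⊗ₜ 1)
      (dualAct (tensorCoaction δ regularCoaction) ψ (y ⊗ₜ 1)) = T x y * ψ.ofConv θ := by
  rw [dualAct_apply, tensorCoaction_tmul, apply_contr,
    contrLeft_mulRightFactors (T x) (unitForm (R := R) θ 1) _ (by intro m n; simp [mul_comm]),
    contrLeft_unitForm_regularCoaction, hθ, map_smul, smul_eq_mul]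
  congr 1
  have h := apply_contr (T x) (1 : DualAlg R A) (δ y)
  rw [← dualAct_apply, hδ.dualAct_one, dual_one_apply] at h
  exact h.symm

/-- The isometry is inverse to `x ↦ v⁻¹ ψ(x ⊗ 1)`; the factor `v⁻¹`, occurring twice in the form,
absorbs `ψ(θ) = v²`. Injectivity comes from that of the adjoint of `T`, and surjectivity from
`exists_dualAct_tmul_one`. -/
theorem exists_equiv_of_isFixedPointForm (hδ : IsComodule δ)
    (hθ : ∀ a : A, a * θ = counit (R := R) a • θ)
    (hψ : ∀ h : DualAlg R A, ψ * h = h.ofConv 1 • ψ)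
    {T : LinearMap.BilinForm R D} (hT : Function.Injective T) {v : Rˣ} (hv : ψ.ofConv θ = v ^ 2)
    {κt : LinearMap.BilinForm R (fixedPoints (tensorCoaction δ (regularCoaction (R := R) (A := A))))}
    (hκ : IsFixedPointForm (tensorCoaction δ regularCoaction)
      (LinearMap.BilinForm.tmul T (unitForm (R := R) θ)) ψ κt) :
    Isometric κt T := by
  have hmem : ∀ z, dualAct (tensorCoaction δ regularCoaction) ψ z ∈
      fixedPoints (tensorCoaction δ (regularCoaction (R := R) (A := A))) := fun z => by
    rw [← hκ.range_eq]; exact ⟨z, rfl⟩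
  let E : D →ₗ[R] fixedPoints (tensorCoaction δ (regularCoaction (R := R) (A := A))) :=
    (↑v⁻¹ : R) • ((dualAct (tensorCoaction δ regularCoaction) ψ).codRestrict _ hmem ∘ₗ
      (TensorProduct.mk R D (DualAlg R A)).flip 1)
  have hE : ∀ x, (E x : D ⊗[R] DualAlg R A) =
      dualAct (tensorCoaction δ regularCoaction) ψ ((↑v⁻¹ : R) • (x ⊗ₜ 1)) := by
    intro x
    rw [map_smul]
    rfl
  have hiso : ∀ x y, κt (E x) (E y) = T x y := by
    intro x y
    rw [hκ.left _ _ _ (hE x).symm, hE, map_smul, map_smul, LinearMap.smul_apply, map_smul,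
      tmul_unitForm_dualAct hδ hθ, hv]
    have h1 : (↑v⁻¹ : R) * v = 1 := v.inv_mul
    simp only [smul_eq_mul]
    linear_combination (T x y) * ((↑v⁻¹ : R) * v + 1) * h1
  have hinj : Function.Injective E := by
    intro x y hxy
    apply hT
    ext z
    rw [← hiso, ← hiso, hxy]
  have hsurj : Function.Surjective E := by
    rintro ⟨n, hn⟩
    rw [← hκ.range_eq] at hn
    obtain ⟨z, rfl⟩ := hn
    obtain ⟨x, hx⟩ := exists_dualAct_tmul_one hδ hψ z
    refine ⟨(v : R) • x, Subtype.ext ?_⟩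
    rw [hE, TensorProduct.smul_tmul', smul_smul, v.inv_mul, one_smul]
    exact hx
  refine ⟨(LinearEquiv.ofBijective E ⟨hinj, hsurj⟩).symm, fun m n => ?_⟩
  rw [← hiso]
  congr 1
  · exact congrArg κt ((LinearEquiv.ofBijective E ⟨hinj, hsurj⟩).apply_symm_apply m)
  · exact (LinearEquiv.ofBijective E ⟨hinj, hsurj⟩).apply_symm_apply n

end RegularTwist

theorem IsSymmetricBundle.of_isometric {M : Type*} [AddCommMonoid M] [Module R M] {N : Type*}
    [AddCommMonoid N] [Module R N] {q : LinearMap.BilinForm R M} {q' : LinearMap.BilinForm R N}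
    (h : Isometric q q') (hq' : IsSymmetricBundle q') : IsSymmetricBundle q := by
  obtain ⟨e, he⟩ := h
  have := hq'.finite
  have := hq'.projective
  refine ⟨Module.Finite.equiv e.symm, Module.Projective.of_equiv e.symm, fun m n => ?_, ?_⟩
  · rw [← he, ← he, hq'.symm]
  · have h1 : (q : M → M →ₗ[R] R) = e.dualMap ∘ q' ∘ e := by
      ext m n
      exact (he m n).symm
    rw [h1]
    exact e.dualMap.bijective.comp (hq'.nondegenerate.comp e.bijective)

theorem isSymmetricBundle_of_casimir {B : Type*} [CommRing B] [Algebra R B] [Module.Finite R B]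
    [Module.Free R B] {τ : B →ₗ[R] R} {C : B ⊗[R] B}
    (hC : ∀ b, TensorProduct.rid R B ((τ ∘ₗ LinearMap.mulRight R b).lTensor B C) = b) :
    IsSymmetricBundle ((LinearMap.mul R B).compr₂ τ) where
  finite := inferInstance
  projective := inferInstance
  symm b c := by simp [mul_comm]
  nondegenerate := bijective_of_casimir hC

/-- The two factors `s⁻¹` contribute `s⁻²`, which cancels the `s²` in the trace of `B`. -/
theorem isTraceForm_of_trace_eq [IsDomain R] {K : Type*} [Field K] [Algebra R K]
    [IsFractionRing R K] {B : Type*} [CommRing B] [Algebra R B] [Module.Finite R B]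
    [Module.Free R B] {τ : B →ₗ[R] R} {s : R⁰}
    (hτ : ∀ b, Algebra.trace R B b = (s : R) ^ 2 * τ b)
    {T : LinearMap.BilinForm R (sqrtCodiff K B (s : R))}
    (hT : ∀ b c, T (sqrtCodiffEquiv K B s b) (sqrtCodiffEquiv K B s c) = τ (b * c)) :
    IsTraceForm T := by
  intro x y
  obtain ⟨b, rfl⟩ := (sqrtCodiffEquiv K B s).surjective x
  obtain ⟨c, rfl⟩ := (sqrtCodiffEquiv K B s).surjective y
  have hs : algebraMap R K (s : R) ≠ 0 := by simp
  have h1 : ((sqrtCodiffEquiv K B s b : K ⊗[R] B) * (sqrtCodiffEquiv K B s c : K ⊗[R] B)) =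
      ((algebraMap R K s)⁻¹ * (algebraMap R K s)⁻¹) • ((1 : K) ⊗ₜ[R] (b * c)) := by
    change ((algebraMap R K s)⁻¹ ⊗ₜ[R] b) * ((algebraMap R K s)⁻¹ ⊗ₜ[R] c) = _
    simp [TensorProduct.smul_tmul']
  have h2 : Algebra.trace K (K ⊗[R] B) ((1 : K) ⊗ₜ[R] (b * c)) =
      algebraMap R K (Algebra.trace R B (b * c)) := by
    rw [Algebra.trace_apply, Algebra.trace_apply, ← LinearMap.trace_baseChange]
    congr 1
    ext z
    simp
  rw [hT, h1, map_smul, h2, hτ, map_mul (algebraMap R K), map_pow, smul_eq_mul]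
  field_simp

end Torsors

end HopfTwist

/-! ### The main theorem -/

open scoped TensorProduct nonZeroDivisors in
theorem proposition5p1 {R : Type*} [CommRing R] [IsDomain R] [IsPrincipalIdealRing R]
    (h2 : IsUnit (2 : R))
    (K : Type*) [Field K] [Algebra R K] [IsFractionRing R K]
    {A : Type*} [CommRing A] [HopfAlgebra R A] [Module.Finite R A] [Module.Flat R A]
    (θ : A) (hθ : HopfTwist.IsIntegralGenerator R θ) :
    HopfTwist.IsEquivariantSymmetricBundle HopfTwist.regularCoaction
      (HopfTwist.unitForm (R := R) θ) ∧
    (HopfTwist.HypothesisH2 R A K → IsSquare (Coalgebra.counit (R := R) θ) →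
      ∀ (B : Type*) [CommRing B] [Algebra R B] [Module.Finite R B] [Module.Flat R B]
        (α : B →ₐ[R] B ⊗[R] A), HopfTwist.IsPHS α →
      ∀ s : R⁰, (HopfTwist.integrals R A).map (Coalgebra.counit (R := R) (A := A)) =
          (Ideal.span {(s : R)} ^ 2 : Ideal R) →
      ∃ (T : LinearMap.BilinForm R (HopfTwist.sqrtCodiff K B (s : R)))
        (κt : LinearMap.BilinForm R (HopfTwist.fixedPoints (HopfTwist.tensorCoaction
          (HopfTwist.sqrtCodiffCoaction K α s) (HopfTwist.regularCoaction (R := R) (A := A))))),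
        HopfTwist.IsTraceForm T ∧ HopfTwist.IsSymmetricBundle T ∧
        HopfTwist.IsTwist α s HopfTwist.regularCoaction (HopfTwist.unitForm (R := R) θ) κt ∧
        HopfTwist.IsSymmetricBundle κt ∧
        HopfTwist.Isometric κt T) := by
  have hfree : Module.Free R A := inferInstance
  refine ⟨hθ.isEquivariantSymmetricBundle_unitForm, ?_⟩
  rintro - ⟨r, hr⟩ B _ _ _ _ α hα s hs
  have hfreeB : Module.Free R B := inferInstance
  have hs0 : (s : R) ≠ 0 := nonZeroDivisors.ne_zero s.2
  -- Both `ε(θ) = r²` and `s²` generate `Λ`. As `R` is integrally closed, `s² ∣ r²` gives `r = s v`,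
  -- and `v²` is a unit. That `ε(θ)` is a square is what makes the discrepancy the square of a unit.
  obtain ⟨v, hv⟩ : ∃ v : Rˣ, Coalgebra.counit (R := R) θ = ((s : R) * v) ^ 2 := by
    rw [← show Submodule.span R {θ} = _ from hθ, Submodule.map_span, Set.image_singleton,
      Ideal.span_singleton_pow] at hs
    obtain ⟨u, hu⟩ := (Ideal.span_singleton_eq_span_singleton (α := R)).mp hs.symm
    have hdvd : (s : R) ^ 2 ∣ r ^ 2 := ⟨u, by rw [hu, hr, sq]⟩
    obtain ⟨v, rfl⟩ := (IsIntegrallyClosed.pow_dvd_pow_iff two_ne_zero).mp hdvd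
    have hvu : v ^ 2 = u := by
      apply mul_left_cancel₀ (pow_ne_zero 2 hs0)
      rw [hu, hr]; ring
    have hvunit : IsUnit v := (isUnit_pow_iff two_ne_zero).mp (hvu ▸ u.isUnit)
    exact ⟨hvunit.unit, by rw [hr]; simp [sq]⟩
  -- The twist is normalised by the generator with counit exactly `s²`, while `κ` keeps the original
  -- `θ`; hence `ψ(θ) = v²` rather than `1`.
  let θs : A := (↑(v⁻¹ ^ 2) : R) • θ
  have hθs : HopfTwist.IsIntegralGenerator R θs := by
    rw [HopfTwist.IsIntegralGenerator, ← show Submodule.span R {θ} = _ from hθ]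
    exact Submodule.span_singleton_group_smul_eq R (v⁻¹ ^ 2) θ
  have hεs : Coalgebra.counit (R := R) θs = (s : R) ^ 2 := by
    rw [map_smul, hv, smul_eq_mul, mul_pow, mul_left_comm, ← Units.val_pow_eq_pow_val,
      ← Units.val_mul]
    simp
  obtain ⟨ψ, hψ⟩ := hθs.bijective.2 1
  replace hψ : HopfTwist.dualAct (Coalgebra.comul (R := R)) ψ θs = 1 := hψ
  have hψθs := HopfTwist.apply_eq_one_of_dualAct_eq_one hψ
  have hψθ : ψ.ofConv θ = (v : R) ^ 2 := by
    have h : θ = ((v : R) ^ 2) • θs := by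
      rw [smul_smul, ← Units.val_pow_eq_pow_val, ← Units.val_mul]
      simp
    rw [h, map_smul, hψθs, smul_eq_mul, mul_one]
  have hleft := hθs.dualAct_dual hψ
  have hS := hθs.dualAntipode_dual hψ (by rw [hεs]; exact pow_ne_zero 2 hs0)
  have hright := hθs.dual_mul hψ hS
  obtain ⟨τ, hτ⟩ := hα.exists_functional hleft
  obtain ⟨C, hC⟩ := hα.exists_casimir θs
  have hcas := hα.isComodule.casimir hθs.mul_eq hψθs hτ hC
  have : Nontrivial B := hα.algebraMap_injective.nontrivial
  obtain ⟨b, hb⟩ := HopfTwist.surjective_of_casimir hcas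
  let σ := HopfTwist.sqrtCodiffEquiv K B s
  let T : LinearMap.BilinForm R (HopfTwist.sqrtCodiff K B (s : R)) :=
    ((LinearMap.mul R B).compr₂ τ).compl₁₂ σ.symm.toLinearMap σ.symm.toLinearMap
  have hT : ∀ b c, T (σ b) (σ c) = τ (b * c) := fun b c => by simp [T]
  have hTrace : HopfTwist.IsTraceForm T := HopfTwist.isTraceForm_of_trace_eq (fun b => by
    rw [hα.isComodule.trace_eq hθs.mul_eq hψθs hτ hC, hεs]) hT
  have hTb : HopfTwist.IsSymmetricBundle T :=
    (HopfTwist.isSymmetricBundle_of_casimir hcas).of_isometric ⟨σ.symm, fun _ _ => rfl⟩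
  have hδ : HopfTwist.IsComodule (HopfTwist.sqrtCodiffCoaction K α s) :=
    HopfTwist.isComodule_conj hα.isComodule σ
  have hq :=
    HopfTwist.IsEquivariantForm.tmul
      (HopfTwist.isEquivariantForm_conj σ hT (hα.functional_equivariant hright hτ))
      hθ.isEquivariantSymmetricBundle_unitForm.equivariant
  obtain ⟨κt, hκ⟩ := hq.exists_isFixedPointForm hS
    (HopfTwist.range_dualAct_tensorCoaction σ hα.isComodule
      HopfTwist.isComodule_regularCoaction hleft (by rw [← hτ, hb, map_one]))
  have hiso : HopfTwist.Isometric κt T := HopfTwist.exists_equiv_of_isFixedPointForm hδ hθ.mul_eq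
    hright hTb.nondegenerate.1 hψθ hκ
  exact ⟨T, κt, hTrace, hTb, ⟨T, θs, ψ, hTrace, hθs, hεs, hψ, hκ⟩, hTb.of_isometric hiso, hiso⟩
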